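/- **Theorem (unconditional energy stability).** Let $N,N_T\ge 1$ be integers, $T>0$, $\varepsilon>0$, $\Delta x=\frac1{N+1}$, $\Delta t=\frac{T}{N_T}$. All spatial indices are taken modulo $N+1$. Piecewise constant functions on the unit torus $\mathbb T=\mathbb R/\mathbb Z$ are identified with their cell values: $(v_i)_{0\le i\le N}$ on the primal mesh (cells of length $\Delta x$ centred at $i\Delta x$) and $(v_{i+\frac12})_{0\le i\le N}$ on the dual mesh (cells of length $\Delta x$ centred at $(i+\frac12)\Delta x$). Put $$(\delta\varphi)_{i+\frac12}=\frac{\varphi_{i+1}-\varphi_i}{\Delta x},\quad (\Delta\varphi)_i=\frac{\varphi_{i+1}-2\varphi_i+\varphi_{i-1}}{\Delta x^2},\quad \langle\varphi\rangle=\sum_{i=0}^N\varphi_i\Delta x,$$ $$\|v\|_{L^p}=\Big(\sum_{i=0}^N|v_i|^p\Delta x\Big)^{1/p}\ (1\le p<\infty),\qquad |\varphi|_{H^1}=\Big(\sum_{i=0}^N|(\delta\varphi)_{i+\frac12}|^2\Delta x\Big)^{1/2}.$$ Let $g:\mathbb R\to\mathbb R$ be Lipschitz continuous, differentiable at $0$,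 with $g(u)\ge\max(u,0)$ for all $u$, and let $G(s,t,w)=s\,g(w)-t\,(g(w)-w)$. For $\rho,\phi$ on the primal and $u$ on the dual mesh define $$\rho_{i+\frac12}=\tfrac12(\rho_i+\rho_{i+1}),\quad \mathcal F_{i+\frac12}=G(\rho_i,\rho_{i+1},u_{i+\frac12}),\quad \mathcal F_i=\tfrac12(\mathcal F_{i+\frac12}+\mathcal F_{i-\frac12}),$$ $$u_i=\begin{cases}u_{i-\frac12}&\text{if }\mathcal F_i\ge0,\\ u_{i+\frac12}&\text{if }\mathcal F_i<0,\end{cases}\qquad \tilde\rho_{i+\frac12}=\begin{cases}\dfrac{G(\rho_i,\rho_{i+1},u_{i+\frac12})-G(\rho_i,\rho_{i+1},0)}{u_{i+\frac12}}&\text{if }u_{i+\frac12}\ne0,\\ \rho_{i+1}-(\rho_{i+1}-\rho_i)\,g'(0)&\text{if }u_{i+\frac12}=0,\end{cases}$$ and, with $h(s)=-(s+1)e^{-s}$, the energy $$\mathcal H(\rho,u,\phi)=\sum_{i=0}^N\Big(\rho_{i+\frac12}\frac{u_{i+\frac12}^2}{2}+\frac{\varepsilon^2}{2}|(\delta\phi)_{i+\frac12}|^2+h(\phi_i)\Big)\Delta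 x .$$ Let $\rho^0,\phi^0$ be given on the primal mesh and $u^0$ on the dual mesh, with $\rho^0_i>0$ and $\varepsilon^2(\Delta\phi^0)_i+e^{-\phi^0_i}=\rho^0_i$ for all $i$. Then there exist $(\rho^n,u^n,\phi^n)_{0\le n\le N_T}$, starting from the given $(\rho^0,u^0,\phi^0)$, that solve the fully implicit scheme: for all $0\le n<N_T$ and all $i$, $$\frac{\rho_i^{n+1}-\rho_i^n}{\Delta t}+\frac{\mathcal F^{n+1}_{i+\frac12}-\mathcal F^{n+1}_{i-\frac12}}{\Delta x}=0,$$ $$\frac{\rho^{n+1}_{i+\frac12}u^{n+1}_{i+\frac12}-\rho^n_{i+\frac12}u^n_{i+\frac12}}{\Delta t}+\frac{\mathcal F^{n+1}_{i+1}u^{n+1}_{i+1}-\mathcal F^{n+1}_iu^{n+1}_i}{\Delta x}=\tilde\rho^{n+1}_{i+\frac12}(\delta\phi^{n+1})_{i+\frac12},$$ $$\varepsilon^2(\Delta\phi^{n+1})_i+e^{-\phi^{n+1}_i}=\rho^{n+1}_i .$$ Moreover this solution satisfies, for $0\le n\le N_T$: $\rho^n_i>0$ for all $i$; $\|\rho^n\|_{L^1}=\|\rho^0\|_{L^1}$;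 and $$\mathcal H(\rho^n,u^n,\phi^n)+\Delta t\sum_{k=1}^{n}\tau^k=\mathcal H(\rho^0,u^0,\phi^0).$$ Here, for $0\le n<N_T$, $\tau^{n+1}\ge0$ is $$\begin{aligned}\tau^{n+1}={}&\sum_{i=0}^N\Big(\mathcal S_i^{n+1}+e^{-\xi_i^n}\frac{(\phi_i^{n+1}-\phi_i^n)^2}{2\Delta t}\Big)\Delta x+\frac{\varepsilon^2}{2\Delta t}\sum_{i=0}^N\big((\delta\phi^{n+1})_{i+\frac12}-(\delta\phi^n)_{i+\frac12}\big)^2\Delta x\\&+\frac{g(0)}{\Delta x}\sum_{i=0}^N\varepsilon^2\big|(\delta\phi^{n+1})_{i+\frac12}-(\delta\phi^{n+1})_{i-\frac12}\big|^2\Delta x+\frac{g(0)}{\Delta x}\sum_{i=0}^N\big|(e^{-\phi_i^{n+1}}-e^{-\phi_{i-1}^{n+1}})(\phi_i^{n+1}-\phi_{i-1}^{n+1})\big|\Delta x,\end{aligned}$$ for some $\xi_i^n$ strictly between $\phi_i^n$ and $\phi_i^{n+1}$ (equal to both if they coincide), where $$\mathcal S_i^{n+1}=-\mathcal F_{i+1}^{n+1}\frac{(u_{i+1}^{n+1}-u_{i+\frac12}^{n+1})^2}{2\Delta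 x}+\mathcal F_i^{n+1}\frac{(u_i^{n+1}-u_{i+\frac12}^{n+1})^2}{2\Delta x}+\rho^n_{i+\frac12}\frac{(u^n_{i+\frac12}-u^{n+1}_{i+\frac12})^2}{2\Delta t}\ge0 .$$ Finally, for $0\le n\le N_T$, with $m^n=\min_i\log\rho_i^n$, $M^n=\max_i\log\rho_i^n$ and $\alpha^n=e^{m^n}$: - $\|e^{-\phi^n}\|_{L^p}\le\|\rho^n\|_{L^p}$ for all $p\in[1,\infty)$, with equality for $p=1$; - $\displaystyle\varepsilon^2\sum_{i=0}^N\Big|\frac{\phi^n_{i+1}-\phi^n_i}{\Delta x}\,\frac{e^{-(p-1)\phi^n_{i+1}}-e^{-(p-1)\phi^n_i}}{\Delta x}\Big|\Delta x\le\|\rho^n\|_{L^p}^p$ for all $p\in[1,\infty)$; - $m^n\le-\phi^n_i\le M^n$ for all $i$, and $m^n\le\langle-\phi^n\rangle\le M^n$; - $\alpha^n\|\phi^n-\langle\phi^n\rangle\|_{L^2}\le\|\rho^n\|_{L^2}+\|\rho^n\|_{L^1}$; - $\displaystyle\varepsilon\,|\phi^n-\langle\phi^n\rangle|_{H^1}\le\frac1{\sqrt{\alpha^n}}\big(\|\rho^n\|_{L^2}+\|\rho^n\|_{L^1}\big)$.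 -/

import Mathlib

open scoped BigOperators NNReal

namespace EPB

noncomputable section

/-! Uniform periodic staggered mesh on the unit torus with `N + 1` cells.  Indices are taken
modulo `N + 1`.  A piecewise constant function on the primal mesh is given by its values `v i` on
the cells `C_i`; one on the dual mesh is given by its values on the cells `C_{i+1/2}`, and
`v i` then stands for `v_{i+1/2}` (so that `v (i - 1)` is `v_{i-1/2}`). -/

/-- Piecewise constant functions on the primal mesh: `v i` is the value on `C_i`. -/
abbrev Primal (N : ℕ) : Type := ZMod (N + 1) → ℝ

/-- Piecewise constant functions on the dual mesh: `v i` is the value on `C_{i+1/2}`. -/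
abbrev Dual (N : ℕ) : Type := ZMod (N + 1) → ℝ

/-- The mesh size `Δx = 1 / (N + 1)`. -/
def dx (N : ℕ) : ℝ := 1 / ((N : ℝ) + 1)

/-- The discrete gradient `(δφ)_{i+1/2}`. -/
def grad {N : ℕ} (φ : Primal N) : Dual N := fun i => (φ (i + 1) - φ i) / dx N

/-- The discrete Laplacian `(Δφ)_i`. -/
def lap {N : ℕ} (φ : Primal N) : Primal N :=
  fun i => (φ (i + 1) - 2 * φ i + φ (i - 1)) / dx N ^ 2

/-- The `L^p` norm on the torus of a piecewise constant function, for real `p ≥ 1`. -/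
def lpNorm {N : ℕ} (p : ℝ) (v : ZMod (N + 1) → ℝ) : ℝ :=
  (∑ i, |v i| ^ p * dx N) ^ (1 / p)

/-- The mean value over the torus. -/
def mean {N : ℕ} (v : Primal N) : ℝ := ∑ i, v i * dx N

/-- The discrete `H^1` semi-norm. -/
def h1Semi {N : ℕ} (φ : Primal N) : ℝ :=
  Real.sqrt (∑ i, |(φ (i + 1) - φ i) / dx N| ^ 2 * dx N)

/-- `min_i log ρ_i`. -/
def minLog {N : ℕ} (ρ : Primal N) : ℝ :=
  Finset.univ.inf' Finset.univ_nonempty fun i => Real.log (ρ i)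

/-- `max_i log ρ_i`. -/
def maxLog {N : ℕ} (ρ : Primal N) : ℝ :=
  Finset.univ.sup' Finset.univ_nonempty fun i => Real.log (ρ i)

/-- The numerical flux function `G(s,t,u) = s g(u) - t (g(u) - u)`. -/
def G (g : ℝ → ℝ) (s t u : ℝ) : ℝ := s * g u - t * (g u - u)

/-- The density on the dual mesh, `ρ_{i+1/2} = (ρ_{i+1} + ρ_i) / 2`. -/
def rhoDual {N : ℕ} (ρ : Primal N) : Dual N := fun i => (ρ (i + 1) + ρ i) / 2

/-- The flux of mass `F_{i+1/2} = G(ρ_i, ρ_{i+1}, u_{i+1/2})`. -/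
def flux {N : ℕ} (g : ℝ → ℝ) (ρ : Primal N) (u : Dual N) : Dual N :=
  fun i => G g (ρ i) (ρ (i + 1)) (u i)

/-- The flux of mass on the primal mesh, `F_i = (F_{i+1/2} + F_{i-1/2}) / 2`. -/
def fluxPrimal {N : ℕ} (g : ℝ → ℝ) (ρ : Primal N) (u : Dual N) : Primal N :=
  fun i => (flux g ρ u i + flux g ρ u (i - 1)) / 2

open Classical in
/-- The upwind velocity `u_i`: it is `u_{i-1/2}` if `F_i ≥ 0` and `u_{i+1/2}` if `F_i < 0`. -/
def uPrimal {N : ℕ} (g : ℝ → ℝ) (ρ : Primal N) (u : Dual N) : Primal N :=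
  fun i => if 0 ≤ fluxPrimal g ρ u i then u (i - 1) else u i

open Classical in
/-- The density in the force term, on the dual mesh. -/
def rhoTilde {N : ℕ} (g : ℝ → ℝ) (ρ : Primal N) (u : Dual N) : Dual N :=
  fun i =>
    if u i ≠ 0 then
      (G g (ρ i) (ρ (i + 1)) (u i) - G g (ρ i) (ρ (i + 1)) 0) / (u i - 0)
    else ρ (i + 1) - (ρ (i + 1) - ρ i) * deriv g 0

/-- The discrete Poisson equation `ε² (Δφ)_i + exp(-φ_i) = ρ_i`. -/
def Poisson {N : ℕ} (ε : ℝ) (ρ φ : Primal N) : Prop :=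
  ∀ i, ε ^ 2 * lap φ i + Real.exp (-φ i) = ρ i

/-- One time step of the fully implicit scheme, from `(ρ, u)` to `(ρ', u', φ')`. -/
structure Step {N : ℕ} (ε dt : ℝ) (g : ℝ → ℝ) (ρ : Primal N) (u : Dual N)
    (ρ' : Primal N) (u' : Dual N) (φ' : Primal N) : Prop where
  continuity : ∀ i,
    (ρ' i - ρ i) / dt + 1 / dx N * (flux g ρ' u' i - flux g ρ' u' (i - 1)) = 0
  momentum : ∀ i,
    (rhoDual ρ' i * u' i - rhoDual ρ i * u i) / dt
      + 1 / dx N * (fluxPrimal g ρ' u' (i + 1) * uPrimal g ρ' u' (i + 1)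
          - fluxPrimal g ρ' u' i * uPrimal g ρ' u' i)
      = rhoTilde g ρ' u' i * grad φ' i
  poisson : Poisson ε ρ' φ'

/-- The function `h(s) = -(s + 1) exp(-s)`. -/
def h (s : ℝ) : ℝ := -(s + 1) * Real.exp (-s)

/-- The discrete total energy. -/
def energy {N : ℕ} (ε : ℝ) (ρ : Primal N) (u : Dual N) (φ : Primal N) : ℝ :=
  ∑ i, (rhoDual ρ i * (u i ^ 2 / 2) + ε ^ 2 / 2 * |(φ (i + 1) - φ i) / dx N| ^ 2 + h (φ i))
    * dx N

/-- The kinetic dissipation `S_i` of a time step from `(ρ, u)` to `(ρ', u')`. -/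
def kinDissipation {N : ℕ} (dt : ℝ) (g : ℝ → ℝ) (ρ : Primal N) (u : Dual N)
    (ρ' : Primal N) (u' : Dual N) (i : ZMod (N + 1)) : ℝ :=
  -(fluxPrimal g ρ' u' (i + 1) * ((uPrimal g ρ' u' (i + 1) - u' i) ^ 2 / (2 * dx N)))
    + fluxPrimal g ρ' u' i * ((uPrimal g ρ' u' i - u' i) ^ 2 / (2 * dx N))
    + rhoDual ρ i * ((u i - u' i) ^ 2 / (2 * dt))

/-- The total dissipation `τ` of a time step from `(ρ, u, φ)` to `(ρ', u', φ')`; `ξ i` is an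
intermediate value between `φ i` and `φ' i`. -/
def dissipation {N : ℕ} (ε dt : ℝ) (g : ℝ → ℝ) (ρ : Primal N) (u : Dual N) (φ : Primal N)
    (ρ' : Primal N) (u' : Dual N) (φ' : Primal N) (ξ : Primal N) : ℝ :=
  (∑ i, (kinDissipation dt g ρ u ρ' u' i
      + Real.exp (-ξ i) * ((φ' i - φ i) ^ 2 / (2 * dt))) * dx N)
    + ε ^ 2 / (2 * dt) *
        ∑ i, ((φ' (i + 1) - φ' i) / dx N - (φ (i + 1) - φ i) / dx N) ^ 2 * dx N
    + g 0 / dx N * ∑ i, ε ^ 2 * |grad φ' i - grad φ' (i - 1)| ^ 2 * dx N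
    + g 0 / dx N *
        ∑ i, |(Real.exp (-φ' i) - Real.exp (-φ' (i - 1))) * (φ' i - φ' (i - 1))| * dx N

/-- The discrete elliptic estimates on the potential `φ`, in terms of the density `ρ`. -/
structure EllipticEstimates {N : ℕ} (ε : ℝ) (ρ φ : Primal N) : Prop where
  exp_lp : ∀ p : ℝ, 1 ≤ p → lpNorm p (fun i => Real.exp (-φ i)) ≤ lpNorm p ρ
  exp_l1 : lpNorm 1 (fun i => Real.exp (-φ i)) = lpNorm 1 ρ
  dx_exp : ∀ p : ℝ, 1 ≤ p →
    ε ^ 2 * ∑ i, |(φ (i + 1) - φ i) / dx N *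
        ((Real.exp (-(p - 1) * φ (i + 1)) - Real.exp (-(p - 1) * φ i)) / dx N)| * dx N
      ≤ lpNorm p ρ ^ p
  max_principle : ∀ i, minLog ρ ≤ -φ i ∧ -φ i ≤ maxLog ρ
  mean_bound : minLog ρ ≤ mean (fun i => -φ i) ∧ mean (fun i => -φ i) ≤ maxLog ρ
  l2_bound : Real.exp (minLog ρ) * lpNorm 2 (fun i => φ i - mean φ) ≤ lpNorm 2 ρ + lpNorm 1 ρ
  h1_bound : ε * h1Semi (fun i => φ i - mean φ)
    ≤ 1 / Real.sqrt (Real.exp (minLog ρ)) * (lpNorm 2 ρ + lpNorm 1 ρ)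

end

end EPB

/-! For a prescribed velocity the density solves a linear implicit transport equation and the
potential a monotone discrete Poisson equation. Substituting both into the momentum equation leaves
a continuous vector field on the space of velocities, `momentumResidual`, and a time step is a zero
of this field. By Brouwer's theorem in its acute angle form (`exists_eq_zero_of_sum_mul_pos`) it
suffices that the field has a positive scalar product with the velocity on one large sphere.

`energy_balance` computes that product for every velocity, not only for solutions: times Δx, it is
the difference quotient in time of the energy plus a nonnegative dissipation. Since `g` grows at
most linearly, the implicit density is at least a constant over U when the largest speed is U, so
the kinetic energy grows at least like U (`mul_le_sum_kinetic_of_transport`). The potential energy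
is bounded below, hence the new energy exceeds the old one on a large sphere. At the zero itself the
same balance is the claimed energy identity.

The transport operator is an M-matrix whose columns all sum to 1/Δt; the resulting ℓ¹ bound
`sum_abs_le_transport` gives solvability, nonnegativity and continuous dependence on the velocity.
For the Poisson equation, a maximum principle and suitable test functions give the bounds, and
comparison gives continuity.

Brouwer's theorem rests on the absence of a C¹ retraction r onto the sphere: the integral over the
ball of det(1 + t(Dr - 1)) is a polynomial in t, equal to the volume of the ball for small t but to
zero at t = 1. -/

section Brouwer

/-! ### Brouwer's theorem by the volume argument. -/

open MeasureTheory Metric Set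

/-- The determinant of `1 + t A` is a polynomial in `t` of degree at most the dimension. -/
theorem LinearMap.exists_polynomial_det_one_add_smul {E : Type*} [AddCommGroup E] [Module ℝ E]
    [FiniteDimensional ℝ E] (A : E →ₗ[ℝ] E) :
    ∃ P : Polynomial ℝ, P.natDegree ≤ Module.finrank ℝ E ∧
      ∀ t : ℝ, P.eval t = LinearMap.det (1 + t • A) := by
  let b := Module.finBasis ℝ E
  refine ⟨_, (Polynomial.natDegree_det_X_add_C_le (LinearMap.toMatrix b b A) 1).trans (by simp),
    fun t => ?_⟩
  rw [← Polynomial.coe_evalRingHom, RingHom.map_det, ← LinearMap.det_toMatrix b]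
  congr 1
  ext i j
  by_cases hij : i = j
  · simp [LinearMap.toMatrix_apply, hij]; ring
  · simp [LinearMap.toMatrix_apply, hij]; ring

variable {E : Type*} [NormedAddCommGroup E] [InnerProductSpace ℝ E]

/-- A function on the closed unit ball vanishing on the unit sphere keeps a Lipschitz constant when
it is extended by zero. -/
theorem LipschitzOnWith.indicator_closedBall [Nontrivial E] {g : E → E} {C : ℝ≥0}
    (hg : LipschitzOnWith C g (closedBall 0 1)) (h0 : ∀ x ∈ sphere (0 : E) 1, g x = 0) :
    LipschitzWith C ((closedBall (0 : E) 1).indicator g) := by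
  have key : ∀ x ∈ closedBall (0 : E) 1, ∀ y ∉ closedBall (0 : E) 1, ‖g x‖ ≤ C * dist x y := by
    intro x hx y hy
    -- `z` is the radial projection of `x` (any unit vector if `x = 0`). Its distance to `x` is at
    -- most 1 - ‖x‖ < ‖y‖ - ‖x‖, hence at most the distance from `x` to `y`.
    obtain ⟨z, hz, hxz⟩ : ∃ z ∈ sphere (0 : E) 1, dist x z ≤ 1 - ‖x‖ := by
      have hx1 : ‖x‖ ≤ 1 := by simpa using hx
      by_cases hx0 : x = 0
      · obtain ⟨z, hz⟩ := exists_norm_eq E (zero_le_one (α := ℝ))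
        exact ⟨z, by simpa using hz, by simp [hx0, hz]⟩
      · have hn : ‖x‖ ≠ 0 := norm_ne_zero_iff.2 hx0
        have hp : 0 < ‖x‖ := norm_pos_iff.2 hx0
        refine ⟨‖x‖⁻¹ • x, by simp [norm_smul, hn], ?_⟩
        have : x - ‖x‖⁻¹ • x = (1 - ‖x‖⁻¹) • x := by rw [sub_smul, one_smul]
        rw [dist_eq_norm, this, norm_smul, Real.norm_eq_abs, abs_of_nonpos]
        · field_simp; linarith
        · have := (one_le_inv₀ hp).2 hx1
          linarith
    have hy1 : 1 < ‖y‖ := by simpa using hy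
    have h1 : ‖g x‖ ≤ C * dist x z := by
      have := hg.dist_le_mul x hx z (sphere_subset_closedBall hz)
      rwa [h0 z hz, dist_zero_right] at this
    refine h1.trans (mul_le_mul_of_nonneg_left ?_ C.2)
    have : ‖y‖ - ‖x‖ ≤ dist x y := by rw [dist_comm, dist_eq_norm]; exact norm_sub_norm_le y x
    linarith
  refine LipschitzWith.of_dist_le_mul fun x y => ?_
  by_cases hx : x ∈ closedBall (0 : E) 1 <;> by_cases hy : y ∈ closedBall (0 : E) 1
  · rw [indicator_of_mem hx, indicator_of_mem hy]; exact hg.dist_le_mul x hx y hy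
  · rw [indicator_of_mem hx, indicator_of_notMem hy, dist_zero_right]; exact key x hx y hy
  · rw [indicator_of_notMem hx, indicator_of_mem hy, dist_zero_left, dist_comm]
    exact key y hy x hx
  · rw [indicator_of_notMem hx, indicator_of_notMem hy, dist_self]
    positivity

/-- A perturbation of the identity by a contraction is a bijection. -/
theorem ContractingWith.bijective_id_add {V : Type*} [NormedAddCommGroup V] [CompleteSpace V]
    {K : ℝ≥0} {g : V → V}
    (hg : ContractingWith K g) : Function.Bijective fun x => x + g x := by
  constructor
  · intro x y hxy
    have h1 : dist x y = dist (g x) (g y) := by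
      have : x - y = g y - g x := by
        simp only at hxy
        rw [sub_eq_sub_iff_add_eq_add, hxy, add_comm]
      rw [dist_comm (g x), dist_eq_norm, dist_eq_norm, this]
    have h2 := hg.2.dist_le_mul x y
    have h3 : (K : ℝ) < 1 := by exact_mod_cast hg.1
    have h4 : 0 ≤ dist x y := dist_nonneg
    exact dist_le_zero.1 (by nlinarith)
  · intro y
    have hc : ContractingWith K fun x => y - g x :=
      ⟨hg.1, LipschitzWith.of_dist_le_mul fun a b => by
        rw [dist_sub_left]; exact hg.2.dist_le_mul a b⟩
    refine ⟨hc.fixedPoint, ?_⟩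
    have := hc.fixedPoint_isFixedPt
    simp only [Function.IsFixedPt] at this
    rw [sub_eq_iff_eq_add] at this
    exact this.symm

/-- The determinant of `1 + A` is positive when `‖A‖ < 1`. -/
theorem LinearMap.det_one_add_pos_of_norm_lt_one [FiniteDimensional ℝ E] (A : E →L[ℝ] E)
    (hA : ‖A‖ < 1) : 0 < LinearMap.det (1 + (A : E →ₗ[ℝ] E)) := by
  obtain ⟨P, -, hP⟩ := LinearMap.exists_polynomial_det_one_add_smul (A : E →ₗ[ℝ] E)
  -- A kernel vector of 1 + tA would satisfy ‖v‖ ≤ ‖A‖‖v‖. So the determinant keeps its sign along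
  -- the segment from 1 to 1 + A.
  have hne : ∀ t ∈ Icc (0 : ℝ) 1, P.eval t ≠ 0 := by
    intro t ht h
    rw [hP] at h
    obtain ⟨v, hv, hv0⟩ := Submodule.exists_mem_ne_zero_of_ne_bot
      (LinearMap.bot_lt_ker_of_det_eq_zero h).ne'
    have h1 : v = -(t • A v) := by
      have : v + t • A v = 0 := by simpa using hv
      exact eq_neg_of_add_eq_zero_left this
    have h2 : ‖v‖ ≤ ‖A‖ * ‖v‖ := by
      calc ‖v‖ = |t| * ‖A v‖ := by
            conv_lhs => rw [h1]
            rw [norm_neg, norm_smul, Real.norm_eq_abs]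
        _ ≤ 1 * ‖A v‖ := by
            gcongr
            rw [abs_of_nonneg ht.1]; exact ht.2
        _ ≤ ‖A‖ * ‖v‖ := by rw [one_mul]; exact A.le_opNorm v
    have h3 : 0 < ‖v‖ := norm_pos_iff.2 hv0
    nlinarith
  have h0 : P.eval 0 = 1 := by rw [hP]; simp
  have h1 : P.eval 1 = LinearMap.det (1 + (A : E →ₗ[ℝ] E)) := by rw [hP]; simp
  rw [← h1]
  by_contra! hneg
  have hivt := intermediate_value_Icc' (zero_le_one (α := ℝ)) (P.continuous.continuousOn)
  obtain ⟨t, ht, ht0⟩ := hivt ⟨hneg, by rw [h0]; exact zero_le_one⟩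
  exact hne t ht ht0

/-- There is no `C¹` retraction of the closed unit ball onto the unit sphere. -/
theorem not_exists_contDiffAt_retraction [FiniteDimensional ℝ E] [Nontrivial E] {r : E → E}
    (hr : ∀ x ∈ closedBall (0 : E) 1, ContDiffAt ℝ 1 r x)
    (hr1 : ∀ x ∈ closedBall (0 : E) 1, ‖r x‖ = 1)
    (hrid : ∀ x ∈ sphere (0 : E) 1, r x = x) : False := by
  let _ : MeasurableSpace E := borel E
  have _ : BorelSpace E := ⟨rfl⟩
  set g : E → E := fun x => r x - x with hgdef
  have hgd : ∀ x ∈ closedBall (0 : E) 1, ContDiffAt ℝ 1 g x := fun x hx =>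
    (hr x hx).sub contDiffAt_id
  obtain ⟨C, hC⟩ : ∃ C, LipschitzOnWith C g (closedBall (0 : E) 1) :=
    ContDiffOn.exists_lipschitzOnWith (n := 1)
      (fun x hx => (hgd x hx).contDiffWithinAt) one_ne_zero (convex_closedBall 0 1)
      (isCompact_closedBall 0 1)
  have hlip := hC.indicator_closedBall (fun x hx => by simp [g, hrid x hx])
  have hgdiff : ∀ x ∈ ball (0 : E) 1, DifferentiableAt ℝ g x := fun x hx =>
    (hgd x (ball_subset_closedBall hx)).differentiableAt one_ne_zero
  have hgn : ∀ x ∈ ball (0 : E) 1, ‖fderiv ℝ g x‖ ≤ C := fun x hx =>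
    norm_fderiv_le_of_lipschitzOn ℝ (isOpen_ball.mem_nhds hx) (hC.mono ball_subset_closedBall)
  -- the volume formula for small `t`
  have hvol : ∀ t : ℝ, 0 ≤ t → t * C < 1 →
      IntegrableOn (fun x => LinearMap.det (1 + t • (fderiv ℝ g x : E →ₗ[ℝ] E)))
        (ball (0 : E) 1) volume ∧
      ∫ x in ball (0 : E) 1, LinearMap.det (1 + t • (fderiv ℝ g x : E →ₗ[ℝ] E))
        = volume.real (ball (0 : E) 1) := by
    intro t ht htC
    set F : E → E := fun x => x + t • g x with hF
    -- `F'` is a bijection of the whole space fixing every point outside the open ball, so it maps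
    -- the ball onto itself; there it agrees with `F`, to which the change of variables applies.
    set F' : E → E := fun x => x + t • (closedBall (0 : E) 1).indicator g x with hF'
    have hcontr : ContractingWith (Real.toNNReal t * C)
        (fun x => t • (closedBall (0 : E) 1).indicator g x) := by
      refine ⟨by rw [← NNReal.coe_lt_coe]; simpa [ht] using htC, LipschitzWith.of_dist_le_mul
        fun x y => ?_⟩
      rw [dist_smul₀, Real.norm_eq_abs, abs_of_nonneg ht, NNReal.coe_mul, Real.coe_toNNReal t ht,
        mul_assoc]
      exact mul_le_mul_of_nonneg_left (hlip.dist_le_mul x y) ht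
    have hbij : Function.Bijective F' := hcontr.bijective_id_add
    have hout : ∀ x ∉ ball (0 : E) 1, F' x = x := by
      intro x hx
      by_cases hx' : x ∈ closedBall (0 : E) 1
      · have : x ∈ sphere (0 : E) 1 := by
          simp only [mem_ball, mem_closedBall, mem_sphere, not_lt] at hx hx' ⊢
          exact le_antisymm hx' hx
        simp [F', indicator_of_mem hx', g, hrid x this]
      · simp [F', indicator_of_notMem hx']
    have himg : F' '' ball (0 : E) 1 = ball 0 1 := by
      apply compl_injective
      rw [← image_compl_eq hbij]
      ext y
      constructor
      · rintro ⟨x, hx, rfl⟩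
        rw [hout x hx]; exact hx
      · intro hy
        exact ⟨y, hy, hout y hy⟩
    have hEq : EqOn F F' (ball (0 : E) 1) := fun x hx => by
      simp [F, F', indicator_of_mem (ball_subset_closedBall hx)]
    have hinj : InjOn F (ball (0 : E) 1) := hEq.injOn_iff.2 (hbij.1.injOn)
    have himg' : F '' ball (0 : E) 1 = ball 0 1 := by rw [hEq.image_eq, himg]
    have hder : ∀ x ∈ ball (0 : E) 1, HasFDerivWithinAt F
        (ContinuousLinearMap.id ℝ E + t • fderiv ℝ g x) (ball 0 1) x := fun x hx =>
      ((hasFDerivAt_id x).add ((hgdiff x hx).hasFDerivAt.const_smul t)).hasFDerivWithinAt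
    have hdet : ∀ x ∈ ball (0 : E) 1,
        |(ContinuousLinearMap.id ℝ E + t • fderiv ℝ g x).det|
          = LinearMap.det (1 + t • (fderiv ℝ g x : E →ₗ[ℝ] E)) := by
      intro x hx
      have hpos := LinearMap.det_one_add_pos_of_norm_lt_one (t • fderiv ℝ g x) (by
        rw [norm_smul, Real.norm_eq_abs, abs_of_nonneg ht]
        exact (mul_le_mul_of_nonneg_left (hgn x hx) ht).trans_lt htC)
      exact abs_of_pos hpos
    have hint := integrableOn_image_iff_integrableOn_abs_det_fderiv_smul volume
      measurableSet_ball hder hinj (fun _ => (1 : ℝ))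
    have heq := integral_image_eq_integral_abs_det_fderiv_smul volume
      measurableSet_ball hder hinj (fun _ => (1 : ℝ))
    rw [himg'] at hint heq
    simp only [smul_eq_mul, mul_one] at hint heq
    constructor
    · refine (hint.1 ?_).congr_fun hdet measurableSet_ball
      exact integrableOn_const (measure_ball_lt_top).ne
    · rw [← setIntegral_congr_fun measurableSet_ball hdet, ← heq]
      simp
  -- the determinant of the derivative of the retraction vanishes
  have hdet0 : ∀ x ∈ ball (0 : E) 1,
      LinearMap.det (1 + (1 : ℝ) • (fderiv ℝ g x : E →ₗ[ℝ] E)) = 0 := by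
    intro x hx
    have hrd : DifferentiableAt ℝ r x :=
      (hr x (ball_subset_closedBall hx)).differentiableAt one_ne_zero
    have hfd : (1 + (1 : ℝ) • (fderiv ℝ g x : E →ₗ[ℝ] E)) = (fderiv ℝ r x : E →ₗ[ℝ] E) := by
      have : fderiv ℝ g x = fderiv ℝ r x - ContinuousLinearMap.id ℝ E :=
        (hrd.hasFDerivAt.sub (hasFDerivAt_id x)).fderiv
      rw [this]
      ext v
      simp
    rw [hfd]
    by_contra hne
    have hsurj : Function.Surjective (fderiv ℝ r x) :=
      (LinearMap.equivOfDetNeZero _ hne).surjective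
    obtain ⟨v, hv⟩ := hsurj (r x)
    -- ‖r‖² is constant, so every value of the derivative of `r` is orthogonal to `r x`;
    -- surjectivity would make `r x` itself such a value.
    have hconst : HasFDerivAt (fun y => inner ℝ (r y) (r y)) (0 : E →L[ℝ] ℝ) x := by
      refine (hasFDerivAt_const (1 : ℝ) x).congr_of_eventuallyEq ?_
      filter_upwards [isOpen_ball.mem_nhds hx] with y hy
      rw [real_inner_self_eq_norm_sq, hr1 y (ball_subset_closedBall hy)]; norm_num
    have h2 := hconst.unique (hrd.hasFDerivAt.inner ℝ hrd.hasFDerivAt)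
    have h3 := congrArg (fun L : E →L[ℝ] ℝ => L v) h2
    simp [hv, hr1 x (ball_subset_closedBall hx)] at h3
    norm_num at h3
  -- interpolate in `t`
  set n := Module.finrank ℝ E
  obtain ⟨ε, hε, hεC⟩ : ∃ ε : ℝ, 0 < ε ∧ ε * C < 1 := by
    refine ⟨1 / (C + 1), by positivity, ?_⟩
    rw [div_mul_eq_mul_div, one_mul, div_lt_one (by positivity)]
    exact lt_add_one _
  set s := Finset.range (n + 1)
  -- n + 1 distinct nodes in (0, ε], where the volume formula holds. They determine a polynomial of
  -- degree at most n, hence its value at t = 1, where the formula need not apply.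
  set v : ℕ → ℝ := fun j => ε / (j + 1) with hv
  have hv0 : ∀ j, 0 ≤ v j := fun j => by positivity
  have hvC : ∀ j, v j * C < 1 := fun j => by
    refine lt_of_le_of_lt (mul_le_mul_of_nonneg_right ?_ C.2) hεC
    exact div_le_self hε.le (by linarith [Nat.cast_nonneg (α := ℝ) j])
  have hvinj : Set.InjOn v s := by
    intro i _ j _ hij
    simp only [hv] at hij
    rw [div_eq_div_iff (by positivity) (by positivity)] at hij
    have := mul_left_cancel₀ hε.ne' hij
    have : (j : ℝ) = i := by linarith
    exact_mod_cast this.symm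
  have hinterp : ∀ x ∈ ball (0 : E) 1,
      ∑ j ∈ s, LinearMap.det (1 + v j • (fderiv ℝ g x : E →ₗ[ℝ] E))
        * (Lagrange.basis s v j).eval 1 = 0 := by
    intro x hx
    obtain ⟨P, hPdeg, hP⟩ :=
      LinearMap.exists_polynomial_det_one_add_smul (fderiv ℝ g x : E →ₗ[ℝ] E)
    have hPlt : P.degree < s.card := by
      refine Polynomial.degree_le_natDegree.trans_lt ?_
      simp only [s, Finset.card_range]
      exact_mod_cast Nat.lt_succ_of_le hPdeg
    have := congrArg (Polynomial.eval 1) (Lagrange.eq_interpolate hvinj hPlt)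
    rw [hP, hdet0 x hx, Lagrange.interpolate_apply, Polynomial.eval_finsetSum] at this
    rw [this]
    refine Finset.sum_congr rfl fun j _ => ?_
    rw [Polynomial.eval_mul, Polynomial.eval_C, hP]
  have hI : ∫ x in ball (0 : E) 1,
      ∑ j ∈ s, LinearMap.det (1 + v j • (fderiv ℝ g x : E →ₗ[ℝ] E))
        * (Lagrange.basis s v j).eval 1 = 0 := by
    rw [setIntegral_congr_fun (g := fun _ => (0 : ℝ)) measurableSet_ball hinterp]
    simp
  -- Each determinant integrates to the volume of the ball and the Lagrange basis sums to 1, so the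
  -- volume would vanish.
  rw [integral_finsetSum _ fun j _ => ((hvol (v j) (hv0 j) (hvC j)).1.mul_const _)] at hI
  simp_rw [integral_mul_const, (hvol _ (hv0 _) (hvC _)).2] at hI
  rw [← Finset.mul_sum, ← Polynomial.eval_finsetSum,
    Lagrange.sum_basis hvinj ⟨0, by simp [s]⟩, Polynomial.eval_one, mul_one] at hI
  have hpos : 0 < volume.real (ball (0 : E) 1) :=
    ENNReal.toReal_pos (measure_ball_pos volume 0 one_pos).ne' measure_ball_lt_top.ne
  exact hpos.ne' hI

/-- A continuous vector field pointing outwards on the unit sphere has a zero. -/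
theorem exists_eq_zero_of_inner_pos_on_sphere [FiniteDimensional ℝ E] [Nontrivial E]
    {f : E → E} (hf : Continuous f) (hout : ∀ x ∈ sphere (0 : E) 1, 0 < inner ℝ (f x) x) :
    ∃ x, f x = 0 := by
  by_contra! hne
  obtain ⟨m, hm, hm1, hm2⟩ : ∃ m : ℝ, 0 < m ∧ (∀ x ∈ closedBall (0 : E) 1, m ≤ ‖f x‖) ∧
      ∀ x ∈ sphere (0 : E) 1, m ≤ inner ℝ (f x) x := by
    obtain ⟨a, -, ha⟩ := (isCompact_closedBall (0 : E) 1).exists_isMinOn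
      ⟨0, by simp⟩ hf.norm.continuousOn
    obtain ⟨b, hb, hb'⟩ := (isCompact_sphere (0 : E) 1).exists_isMinOn
      (NormedSpace.sphere_nonempty.2 zero_le_one)
      (hf.inner (𝕜 := ℝ) continuous_id).continuousOn
    exact ⟨min ‖f a‖ (inner ℝ (f b) b), lt_min (norm_pos_iff.2 (hne a)) (hout b hb),
      fun x hx => (min_le_left _ _).trans (ha hx), fun x hx => (min_le_right _ _).trans (hb' hx)⟩
  obtain ⟨p, hp, hpf, -⟩ := hf.exists_contDiff_approx 1 (ε := fun _ => m) continuous_const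
    (fun _ => hm)
  have hp0 : ∀ x ∈ closedBall (0 : E) 1, 0 < ‖p x‖ := by
    intro x hx
    have h1 := hpf x
    rw [dist_comm, dist_eq_norm] at h1
    have h2 := norm_sub_norm_le (f x) (p x)
    linarith [hm1 x hx]
  have hpout : ∀ x ∈ sphere (0 : E) 1, 0 < inner ℝ (p x) x := by
    intro x hx
    have h1 := hpf x
    rw [dist_comm, dist_eq_norm] at h1
    have hx1 : ‖x‖ = 1 := by simpa using hx
    have h2 := real_inner_le_norm (f x - p x) x
    rw [inner_sub_left, hx1, mul_one] at h2
    linarith [hm2 x hx]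
  -- `D` is the reduced discriminant of ‖x + λ p(x)‖² = 1 and `lam` the larger root. On the sphere,
  -- where ⟨p(x), x⟩ > 0, this root is 0. Positivity of `D` makes it C¹.
  set D : E → ℝ := fun x => inner ℝ (p x) x ^ 2 + ‖p x‖ ^ 2 * (1 - ‖x‖ ^ 2) with hD
  have hDpos : ∀ x ∈ closedBall (0 : E) 1, 0 < D x := by
    intro x hx
    have hx1 : ‖x‖ ≤ 1 := by simpa using hx
    rcases hx1.lt_or_eq with h | h
    · have h1 : 0 < ‖p x‖ ^ 2 * (1 - ‖x‖ ^ 2) :=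
        mul_pos (pow_pos (hp0 x hx) 2) (by nlinarith [norm_nonneg x])
      positivity
    · have h1 := hpout x (by simpa using h)
      simp only [hD, h]
      norm_num
      positivity
  set lam : E → ℝ := fun x => (-inner ℝ (p x) x + Real.sqrt (D x)) / ‖p x‖ ^ 2 with hlam
  refine not_exists_contDiffAt_retraction (r := fun x => x + lam x • p x) ?_ ?_ ?_
  · intro x hx
    have h1 : ContDiffAt ℝ 1 (fun x => inner ℝ (p x) x) x := hp.contDiffAt.inner ℝ contDiffAt_id
    have h2 : ContDiffAt ℝ 1 (fun x => ‖p x‖ ^ 2) x := hp.contDiffAt.norm_sq ℝ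
    have h3 : ContDiffAt ℝ 1 (fun x : E => ‖x‖ ^ 2) x := contDiffAt_id.norm_sq ℝ
    have h4 : ContDiffAt ℝ 1 D x := (h1.pow 2).add (h2.mul (contDiffAt_const.sub h3))
    have h5 : ContDiffAt ℝ 1 lam x :=
      (h1.neg.add (h4.sqrt (hDpos x hx).ne')).div h2 (pow_pos (hp0 x hx) 2).ne'
    exact contDiffAt_id.add (h5.smul hp.contDiffAt)
  · intro x hx
    have hpx := hp0 x hx
    have hs := Real.sq_sqrt (hDpos x hx).le
    have h1 : ‖x + lam x • p x‖ ^ 2 = 1 := by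
      rw [norm_add_sq_real, inner_smul_right, norm_smul, mul_pow, Real.norm_eq_abs, sq_abs,
        real_inner_comm]
      have hl : lam x * ‖p x‖ ^ 2 = -inner ℝ (p x) x + Real.sqrt (D x) := by
        simp only [hlam]; field_simp
      have h2 : (‖p x‖ ^ 2) * (‖x‖ ^ 2 + 2 * (lam x * inner ℝ (p x) x)
          + lam x ^ 2 * ‖p x‖ ^ 2) = ‖p x‖ ^ 2 * 1 := by
        calc _ = ‖p x‖ ^ 2 * ‖x‖ ^ 2 + 2 * (lam x * ‖p x‖ ^ 2) * inner ℝ (p x) x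
              + (lam x * ‖p x‖ ^ 2) ^ 2 := by ring
          _ = ‖p x‖ ^ 2 * ‖x‖ ^ 2 - inner ℝ (p x) x ^ 2 + Real.sqrt (D x) ^ 2 := by
              rw [hl]; ring
          _ = _ := by rw [hs, hD]; ring
      exact mul_left_cancel₀ (pow_pos hpx 2).ne' h2
    have := norm_nonneg (x + lam x • p x)
    nlinarith
  · intro x hx
    have hx1 : ‖x‖ = 1 := by simpa using hx
    have h1 := hpout x hx
    have : lam x = 0 := by
      simp only [hlam, hD, hx1]
      norm_num
      left
      rw [Real.sqrt_sq h1.le]; ring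
    simp [this]

/-- The acute angle form of Brouwer's theorem in coordinates. -/
theorem exists_eq_zero_of_sum_mul_pos {ι : Type*} [Fintype ι] [Nonempty ι]
    {f : (ι → ℝ) → ι → ℝ} (hf : Continuous f) {R : ℝ} (hR : 0 < R)
    (hout : ∀ x : ι → ℝ, ∑ i, x i ^ 2 = R ^ 2 → 0 < ∑ i, f x i * x i) :
    ∃ x, f x = 0 := by
  obtain ⟨x, hx⟩ := exists_eq_zero_of_inner_pos_on_sphere (E := EuclideanSpace ℝ ι)
    (f := fun x => WithLp.toLp 2 (f (R • WithLp.ofLp x))) (by fun_prop) (by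
      intro x hx
      have hx1 : ∑ i, x i ^ 2 = 1 := by
        have h1 : ‖x‖ = 1 := by simpa using hx
        have := EuclideanSpace.real_norm_sq_eq x
        rw [← this, h1]; norm_num
      have h2 := hout (R • WithLp.ofLp x) (by
        simp only [Pi.smul_apply, smul_eq_mul, mul_pow, ← Finset.mul_sum]
        rw [hx1, mul_one])
      have h3 : ∑ i, f (R • WithLp.ofLp x) i * (R • WithLp.ofLp x) i
          = R * ∑ i, f (R • WithLp.ofLp x) i * x i := by
        rw [Finset.mul_sum]
        exact Finset.sum_congr rfl fun i _ => by simp; ring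
      rw [h3] at h2
      have h4 := pos_of_mul_pos_right h2 hR.le
      simpa [PiLp.inner_apply, mul_comm] using h4)
  exact ⟨R • WithLp.ofLp x, by simpa using congrArg WithLp.ofLp hx⟩

end Brouwer

/-! ### Summation by parts on the periodic mesh. -/

namespace EPB

theorem dx_pos (N : ℕ) : 0 < dx N := by unfold dx; positivity

theorem sum_dx (N : ℕ) : ∑ _i : ZMod (N + 1), dx N = 1 := by
  rw [Finset.sum_const, Finset.card_univ, ZMod.card, nsmul_eq_mul, dx]
  push_cast
  field_simp

theorem sum_shift {N : ℕ} (f : ZMod (N + 1) → ℝ) : ∑ i, f (i + 1) = ∑ i, f i :=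
  Equiv.sum_comp (Equiv.addRight (1 : ZMod (N + 1))) f

theorem sum_shift_sub {N : ℕ} (f : ZMod (N + 1) → ℝ) : ∑ i, f (i - 1) = ∑ i, f i :=
  Equiv.sum_comp (Equiv.subRight (1 : ZMod (N + 1))) f

/-- Summation by parts on the torus. -/
theorem sum_mul_sub_eq_neg {N : ℕ} (a b : ZMod (N + 1) → ℝ) :
    ∑ i, a i * (b i - b (i - 1)) = -∑ i, (a (i + 1) - a i) * b i := by
  have h := sum_shift_sub fun i => a (i + 1) * b i
  simp only [sub_add_cancel] at h
  simp only [mul_sub, sub_mul, Finset.sum_sub_distrib]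
  rw [h]
  ring

theorem lap_eq {N : ℕ} (φ : Primal N) (i : ZMod (N + 1)) :
    lap φ i = (grad φ i - grad φ (i - 1)) / dx N := by
  have := (dx_pos N).ne'
  simp only [lap, grad, sub_add_cancel]
  field_simp
  ring

theorem sum_mul_lap {N : ℕ} (φ ψ : Primal N) :
    ∑ i, ψ i * lap φ i = -∑ i, grad ψ i * grad φ i := by
  have h := sum_mul_sub_eq_neg ψ (grad φ)
  simp only [lap_eq, mul_div_assoc', ← Finset.sum_div]
  rw [h, neg_div, Finset.sum_div]
  congr 1
  exact Finset.sum_congr rfl fun i _ => by simp only [grad]; ring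

/-! ### Norms -/

theorem lpNorm_rpow {N : ℕ} {p : ℝ} (hp : 0 < p) (v : ZMod (N + 1) → ℝ) :
    lpNorm p v ^ p = ∑ i, |v i| ^ p * dx N := by
  have h0 : 0 ≤ ∑ i, |v i| ^ p * dx N :=
    Finset.sum_nonneg fun i _ => mul_nonneg (Real.rpow_nonneg (abs_nonneg _) _) (dx_pos N).le
  rw [lpNorm, ← Real.rpow_mul h0, one_div_mul_cancel hp.ne', Real.rpow_one]

theorem lpNorm_nonneg {N : ℕ} (p : ℝ) (v : ZMod (N + 1) → ℝ) : 0 ≤ lpNorm p v :=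
  Real.rpow_nonneg (Finset.sum_nonneg fun _ _ =>
    mul_nonneg (Real.rpow_nonneg (abs_nonneg _) _) (dx_pos N).le) _

theorem lpNorm_two_sq {N : ℕ} (v : ZMod (N + 1) → ℝ) :
    lpNorm 2 v ^ 2 = ∑ i, v i ^ 2 * dx N := by
  have := lpNorm_rpow two_pos v
  simpa only [Real.rpow_two, sq_abs] using this

theorem lpNorm_one_of_nonneg {N : ℕ} {v : ZMod (N + 1) → ℝ} (hv : ∀ i, 0 ≤ v i) :
    lpNorm 1 v = ∑ i, v i * dx N := by
  simp [lpNorm, abs_of_nonneg (hv _)]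

theorem sum_mul_dx_le_lpNorm_two_mul {N : ℕ} (v w : ZMod (N + 1) → ℝ) :
    |∑ i, v i * w i * dx N| ≤ lpNorm 2 v * lpNorm 2 w := by
  refine abs_le_of_sq_le_sq ?_ (mul_nonneg (lpNorm_nonneg _ _) (lpNorm_nonneg _ _))
  rw [mul_pow, lpNorm_two_sq, lpNorm_two_sq]
  simp only [← Finset.sum_mul]
  have := Finset.sum_mul_sq_le_sq_mul_sq Finset.univ v w
  nlinarith [mul_le_mul_of_nonneg_left this (sq_nonneg (dx N))]

theorem exp_minLog_le {N : ℕ} {ρ : Primal N} (hρ : ∀ i, 0 < ρ i) (i : ZMod (N + 1)) :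
    Real.exp (minLog ρ) ≤ ρ i := by
  rw [← Real.le_log_iff_exp_le (hρ i)]
  exact Finset.inf'_le _ (Finset.mem_univ i)

theorem le_exp_maxLog {N : ℕ} {ρ : Primal N} (hρ : ∀ i, 0 < ρ i) (i : ZMod (N + 1)) :
    ρ i ≤ Real.exp (maxLog ρ) := by
  rw [← Real.log_le_iff_le_exp (hρ i)]
  exact Finset.le_sup' (fun i => Real.log (ρ i)) (Finset.mem_univ i)

/-! ### The discrete Poisson equation -/

/-- Comparison of two solutions at a maximum point of their difference. -/
theorem Poisson.exists_isMax_sub {N : ℕ} {ε : ℝ} {ρ₁ φ₁ ρ₂ φ₂ : Primal N}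
    (h₁ : Poisson ε ρ₁ φ₁) (h₂ : Poisson ε ρ₂ φ₂) :
    ∃ i, (∀ j, φ₁ j - φ₂ j ≤ φ₁ i - φ₂ i) ∧
      ρ₁ i - Real.exp (-φ₁ i) ≤ ρ₂ i - Real.exp (-φ₂ i) := by
  obtain ⟨i, -, hi⟩ := Finset.exists_max_image Finset.univ (fun j => φ₁ j - φ₂ j)
    Finset.univ_nonempty
  replace hi : ∀ j, φ₁ j - φ₂ j ≤ φ₁ i - φ₂ i := fun j => hi j (Finset.mem_univ j)
  refine ⟨i, hi, ?_⟩
  -- The second difference of φ₁ - φ₂ is nonpositive at a maximum point.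
  have hlap : lap φ₁ i ≤ lap φ₂ i :=
    div_le_div_of_nonneg_right (by linarith [hi (i + 1), hi (i - 1)]) (sq_nonneg _)
  have := mul_le_mul_of_nonneg_left hlap (sq_nonneg ε)
  linarith [h₁ i, h₂ i]

/-- Constants serve as barriers in the maximum principle. -/
theorem poisson_const {N : ℕ} (ε c : ℝ) :
    Poisson (N := N) ε (fun _ => Real.exp (-c)) fun _ => c := by
  intro i
  have : lap (N := N) (fun _ => c) i = 0 := by simp [lap]; left; ring
  simp [this]

theorem Poisson.minLog_le_neg {N : ℕ} {ε : ℝ} {ρ φ : Primal N} (hρ : ∀ i, 0 < ρ i)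
    (h : Poisson ε ρ φ) (j : ZMod (N + 1)) : minLog ρ ≤ -φ j := by
  obtain ⟨i, hi, hle⟩ := h.exists_isMax_sub (poisson_const ε 0)
  have h1 : Real.exp (minLog ρ) ≤ Real.exp (-φ i) := by linarith [exp_minLog_le hρ i]
  have h2 := Real.exp_le_exp.1 h1
  linarith [hi j]

theorem Poisson.neg_le_maxLog {N : ℕ} {ε : ℝ} {ρ φ : Primal N} (hρ : ∀ i, 0 < ρ i)
    (h : Poisson ε ρ φ) (j : ZMod (N + 1)) : -φ j ≤ maxLog ρ := by
  obtain ⟨i, hi, hle⟩ := (poisson_const ε 0).exists_isMax_sub h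
  have h1 : Real.exp (-φ i) ≤ Real.exp (maxLog ρ) := by linarith [le_exp_maxLog hρ i]
  have h2 := Real.exp_le_exp.1 h1
  linarith [hi j]

/-- The weak form; the integral estimates come from different choices of `ψ`. -/
theorem Poisson.sum_mul {N : ℕ} {ε : ℝ} {ρ φ : Primal N} (h : Poisson ε ρ φ) (ψ : Primal N) :
    ∑ i, ψ i * ρ i = -(ε ^ 2 * ∑ i, grad ψ i * grad φ i) + ∑ i, ψ i * Real.exp (-φ i) := by
  have := sum_mul_lap φ ψ
  rw [← mul_neg, ← this, Finset.mul_sum, ← Finset.sum_add_distrib]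
  exact Finset.sum_congr rfl fun i _ => by rw [← h i]; ring

theorem sub_mul_exp_sub_exp_nonpos {c : ℝ} (hc : 0 ≤ c) (a b : ℝ) :
    (a - b) * (Real.exp (-c * a) - Real.exp (-c * b)) ≤ 0 := by
  rcases le_total a b with hab | hab
  · exact mul_nonpos_of_nonpos_of_nonneg (by linarith)
      (sub_nonneg.2 (Real.exp_le_exp.2 (by nlinarith)))
  · exact mul_nonpos_of_nonneg_of_nonpos (by linarith)
      (sub_nonpos.2 (Real.exp_le_exp.2 (by nlinarith)))

/-- Strong monotonicity of the exponential on [m, ∞), from exp(s - t) ≥ 1 + s - t. It supplies the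
coercive L² term in the Poisson equation. -/
theorem exp_mul_sq_le_of_le {m s t : ℝ} (hs : m ≤ s) (ht : m ≤ t) :
    Real.exp m * (s - t) ^ 2 ≤ (Real.exp s - Real.exp t) * (s - t) := by
  wlog hst : t ≤ s generalizing s t
  · have := this ht hs (le_of_not_ge hst)
    nlinarith
  have h1 : Real.exp s = Real.exp t * Real.exp (s - t) := by rw [← Real.exp_add]; ring_nf
  have h2 := Real.add_one_le_exp (s - t)
  have h3 := Real.exp_le_exp.2 ht
  have h4 : Real.exp m * (s - t) ≤ Real.exp s - Real.exp t := by
    have h5 : Real.exp m * (s - t) ≤ Real.exp t * (s - t) :=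
      mul_le_mul_of_nonneg_right h3 (by linarith)
    have h6 := mul_le_mul_of_nonneg_left h2 (Real.exp_pos t).le
    rw [h1]; linarith
  have := mul_le_mul_of_nonneg_right h4 (sub_nonneg.2 hst)
  linarith

/-- Young's inequality in the form used for the `L^p` estimates. -/
theorem mul_exp_le_rpow_add {p r s : ℝ} (hp : 1 ≤ p) (hr : 0 ≤ r) :
    Real.exp (-(p - 1) * s) * r
      ≤ 1 / p * r ^ p + (1 - 1 / p) * Real.exp (-s) ^ p := by
  have hp0 : 0 < p := by linarith
  have hp1 : 1 / p ≤ 1 := (div_le_one hp0).2 hp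
  have := Real.geom_mean_le_arith_mean2_weighted (w₁ := 1 / p) (w₂ := 1 - 1 / p)
    (p₁ := r ^ p) (p₂ := Real.exp (-s) ^ p) (by positivity) (by linarith)
    (Real.rpow_nonneg hr _) (by positivity) (by ring)
  rw [← Real.rpow_mul hr, mul_one_div_cancel hp0.ne', Real.rpow_one, ← Real.exp_mul,
    ← Real.exp_mul] at this
  rw [← Real.exp_mul]
  have he : -s * p * (1 - 1 / p) = -(p - 1) * s := by field_simp
  rw [he] at this
  linarith

/-- The `L^p` energy estimate for the Poisson equation. -/
theorem Poisson.lp_estimate {N : ℕ} {ε : ℝ} {ρ φ : Primal N} (hρ : ∀ i, 0 < ρ i)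
    (h : Poisson ε ρ φ) {p : ℝ} (hp : 1 ≤ p) :
    ε ^ 2 * ∑ i, |(φ (i + 1) - φ i) / dx N *
        ((Real.exp (-(p - 1) * φ (i + 1)) - Real.exp (-(p - 1) * φ i)) / dx N)| * dx N
      + 1 / p * ∑ i, Real.exp (-φ i) ^ p * dx N ≤ 1 / p * ∑ i, ρ i ^ p * dx N := by
  have hd := dx_pos N
  have h1 := h.sum_mul fun i => Real.exp (-(p - 1) * φ i)
  have habs : ∀ i, |(φ (i + 1) - φ i) / dx N *
        ((Real.exp (-(p - 1) * φ (i + 1)) - Real.exp (-(p - 1) * φ i)) / dx N)|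
      = -(grad (fun i => Real.exp (-(p - 1) * φ i)) i * grad φ i) := by
    intro i
    simp only [grad]
    rw [abs_of_nonpos]
    · ring
    · rw [div_mul_div_comm]
      exact div_nonpos_of_nonpos_of_nonneg
        (sub_mul_exp_sub_exp_nonpos (by linarith) _ _) (by positivity)
  have h2 : ∀ i, Real.exp (-(p - 1) * φ i) * Real.exp (-φ i) = Real.exp (-φ i) ^ p := by
    intro i
    rw [← Real.exp_mul, ← Real.exp_add]; ring_nf
  have h3 : ∑ i, Real.exp (-(p - 1) * φ i) * ρ i
      ≤ 1 / p * ∑ i, ρ i ^ p + (1 - 1 / p) * ∑ i, Real.exp (-φ i) ^ p := by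
    rw [Finset.mul_sum, Finset.mul_sum, ← Finset.sum_add_distrib]
    exact Finset.sum_le_sum fun i _ => mul_exp_le_rpow_add hp (hρ i).le
  simp only [habs, h2, ← Finset.sum_mul, Finset.sum_neg_distrib] at h1 ⊢
  rw [h1] at h3
  nlinarith

/-- The test function exp(-(p-1)φ) gives the L^p bounds, 1 the equality of masses, and φ minus its
mean the L² and H¹ bounds. The latter already hold without the L¹ norm on the right. -/
theorem Poisson.ellipticEstimates {N : ℕ} {ε : ℝ} {ρ φ : Primal N}
    (hρ : ∀ i, 0 < ρ i) (h : Poisson ε ρ φ) : EllipticEstimates ε ρ φ := by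
  have hd := dx_pos N
  have hmax : ∀ i, minLog ρ ≤ -φ i ∧ -φ i ≤ maxLog ρ := fun i =>
    ⟨h.minLog_le_neg hρ i, h.neg_le_maxLog hρ i⟩
  have hconst : ∀ c : ℝ, c = ∑ _i : ZMod (N + 1), c * dx N := fun c => by
    rw [← Finset.mul_sum, sum_dx, mul_one]
  have hmean : minLog ρ ≤ mean (fun i => -φ i) ∧ mean (fun i => -φ i) ≤ maxLog ρ := by
    constructor
    · rw [hconst (minLog ρ)]
      exact Finset.sum_le_sum fun i _ => mul_le_mul_of_nonneg_right (hmax i).1 hd.le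
    · rw [hconst (maxLog ρ)]
      exact Finset.sum_le_sum fun i _ => mul_le_mul_of_nonneg_right (hmax i).2 hd.le
  have hdiss : ∀ p : ℝ, 0 ≤ ε ^ 2 * ∑ i, |(φ (i + 1) - φ i) / dx N *
        ((Real.exp (-(p - 1) * φ (i + 1)) - Real.exp (-(p - 1) * φ i)) / dx N)| * dx N :=
    fun p => mul_nonneg (sq_nonneg _) (Finset.sum_nonneg fun i _ => by positivity)
  have habs : ∀ i, |ρ i| = ρ i := fun i => abs_of_pos (hρ i)
  -- the `L²` estimates
  set c := mean φ
  set ψ : Primal N := fun i => φ i - c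
  have hmneg : mean (fun i => -φ i) = -c := by
    simp [c, mean, Finset.sum_neg_distrib]
  have hψ0 : ∑ i, ψ i = 0 := by
    have h1 : ∑ i, ψ i * dx N = 0 := by
      simp only [ψ, sub_mul, Finset.sum_sub_distrib]
      rw [← hconst c]
      simp [c, mean]
    rw [← Finset.sum_mul] at h1
    exact (mul_eq_zero.1 h1).resolve_right hd.ne'
  have hgψ : ∀ i, grad ψ i = grad φ i := fun i => by simp [grad, ψ]
  have hα := Real.exp_pos (minLog ρ)
  have hkey : ε ^ 2 * ∑ i, grad φ i ^ 2 * dx N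
      + Real.exp (minLog ρ) * lpNorm 2 ψ ^ 2 ≤ lpNorm 2 ρ * lpNorm 2 ψ := by
    have h1 := h.sum_mul ψ
    -- Since ψ has mean zero, the constant e^{-c} can be subtracted from e^{-φ}; strong monotonicity
    -- then applies, both -φ_i and -c being at least `minLog ρ`.
    have h2 : Real.exp (minLog ρ) * ∑ i, ψ i ^ 2 ≤ -∑ i, ψ i * Real.exp (-φ i) := by
      have h3 : ∑ i, ψ i * Real.exp (-φ i)
          = -∑ i, (Real.exp (-φ i) - Real.exp (-c)) * (-φ i - -c) := by
        have : ∑ i, (Real.exp (-φ i) - Real.exp (-c)) * (-φ i - -c)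
            = -∑ i, ψ i * Real.exp (-φ i) + Real.exp (-c) * ∑ i, ψ i := by
          rw [Finset.mul_sum, ← Finset.sum_neg_distrib, ← Finset.sum_add_distrib]
          exact Finset.sum_congr rfl fun i _ => by simp only [ψ]; ring
        rw [this, hψ0]; ring
      rw [h3, neg_neg, Finset.mul_sum]
      refine Finset.sum_le_sum fun i _ => ?_
      have h4 := exp_mul_sq_le_of_le (hmax i).1 (hmneg ▸ hmean.1)
      have h5 : (-φ i - -c) ^ 2 = ψ i ^ 2 := by simp only [ψ]; ring
      rwa [h5] at h4
    have h6 := (neg_abs_le _).trans' (neg_le_neg (sum_mul_dx_le_lpNorm_two_mul ρ ψ))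
    rw [lpNorm_two_sq ψ]
    simp only [hgψ, ← sq, ← Finset.sum_mul, mul_comm (ρ _)] at h1 h6 ⊢
    rw [h1] at h6
    nlinarith [mul_le_mul_of_nonneg_right h2 hd.le]
  have ha := lpNorm_nonneg 2 ψ
  have hb := lpNorm_nonneg 2 ρ
  have hb1 := lpNorm_nonneg 1 ρ
  have hG : 0 ≤ ∑ i, grad φ i ^ 2 * dx N := Finset.sum_nonneg fun i _ => by positivity
  have hl2 : Real.exp (minLog ρ) * lpNorm 2 ψ ≤ lpNorm 2 ρ := by
    rcases ha.eq_or_lt with h0 | h0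
    · rw [← h0, mul_zero]; exact hb
    · refine le_of_mul_le_mul_right ?_ h0
      nlinarith [mul_nonneg (sq_nonneg ε) hG]
  refine ⟨fun p hp => ?_, ?_, fun p hp => ?_, hmax, hmean, hl2.trans (by linarith), ?_⟩
  · have h1 := h.lp_estimate hρ hp
    have hp0 : 0 < 1 / p := by positivity
    refine Real.rpow_le_rpow (Finset.sum_nonneg fun i _ => by positivity) ?_ hp0.le
    simp only [habs, Real.abs_exp]
    exact le_of_mul_le_mul_left (by linarith [hdiss p]) hp0
  · rw [lpNorm_one_of_nonneg fun i => (Real.exp_pos _).le,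
      lpNorm_one_of_nonneg fun i => (hρ i).le, ← Finset.sum_mul, ← Finset.sum_mul]
    have := h.sum_mul fun _ => 1
    simp only [one_mul, grad, sub_self, zero_div, zero_mul, Finset.sum_const_zero, mul_zero,
      neg_zero, zero_add] at this
    rw [this]
  · have h1 := h.lp_estimate hρ hp
    have hp0 : 0 < p := by linarith
    have hp1 : 1 / p ≤ 1 := (div_le_one hp0).2 hp
    rw [lpNorm_rpow hp0]
    simp only [habs]
    have hA : 0 ≤ ∑ i, Real.exp (-φ i) ^ p * dx N := Finset.sum_nonneg fun i _ => by positivity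
    have hB : 0 ≤ ∑ i, ρ i ^ p * dx N := Finset.sum_nonneg fun i _ => by
      have := hρ i
      positivity
    have := mul_nonneg (one_div_pos.2 hp0).le hA
    nlinarith
  · have hs : h1Semi ψ ^ 2 = ∑ i, grad φ i ^ 2 * dx N := by
      rw [h1Semi, Real.sq_sqrt (Finset.sum_nonneg fun i _ => by positivity)]
      exact Finset.sum_congr rfl fun i _ => by rw [sq_abs, ← hgψ i]; rfl
    have hs0 : 0 ≤ h1Semi ψ := Real.sqrt_nonneg _
    have hsq := Real.sq_sqrt hα.le
    have hsp := Real.sqrt_pos.2 hα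
    have h1 : ε * h1Semi ψ * Real.sqrt (Real.exp (minLog ρ)) ≤ lpNorm 2 ρ := by
      refine abs_le_of_sq_le_sq' ?_ hb |>.2
      rw [mul_pow, mul_pow, hsq, hs]
      have h2 : ε ^ 2 * ∑ i, grad φ i ^ 2 * dx N ≤ lpNorm 2 ρ * lpNorm 2 ψ := by
        nlinarith [mul_nonneg hα.le (sq_nonneg (lpNorm 2 ψ))]
      nlinarith [mul_le_mul_of_nonneg_left h2 hα.le, mul_le_mul_of_nonneg_left hl2 hb]
    rw [one_div, ← div_eq_inv_mul, le_div_iff₀ hsp]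
    linarith

/-- The discrete Poisson equation is solvable for every positive density. -/
theorem exists_poisson {N : ℕ} (ε : ℝ) {ρ : Primal N} (hρ : ∀ i, 0 < ρ i) :
    ∃ φ, Poisson ε ρ φ := by
  set α := Real.exp (minLog ρ)
  set M := Real.exp (maxLog ρ)
  have hα : 0 < α := Real.exp_pos _
  have hM : 0 < M := Real.exp_pos _
  -- For s ≥ 0 the loss is e^{-s}s ≤ 1; for s ≤ 0, e^{-s} ≥ 1 - s leaves a square to complete in
  -- |s|, which costs at most (M + α)²/4.
  set C := 1 + (M + α) ^ 2 with hC
  have hlow : ∀ i s, α * |s| - C ≤ (ρ i - Real.exp (-s)) * s := by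
    intro i s
    have hr := exp_minLog_le hρ i
    have hr' := le_exp_maxLog hρ i
    have he := Real.add_one_le_exp (-s)
    rcases le_total 0 s with hs | hs
    · rw [abs_of_nonneg hs]
      have h1 : Real.exp (-s) * s ≤ 1 := by
        have h2 := Real.add_one_le_exp s
        have h3 : Real.exp (-s) * Real.exp s = 1 := by rw [← Real.exp_add]; simp
        nlinarith [Real.exp_pos (-s)]
      nlinarith [mul_le_mul_of_nonneg_right hr hs, sq_nonneg (M + α)]
    · rw [abs_of_nonpos hs]
      nlinarith [mul_le_mul_of_nonneg_right he (neg_nonneg.2 hs),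
        mul_le_mul_of_nonneg_right hr' (neg_nonneg.2 hs), sq_nonneg (s + (M + α) / 2),
        sq_nonneg (M + α), sq_nonneg s]
  -- Chosen so that αR exceeds the total loss (N + 1)C by 1; the ℓ¹ norm dominates the ℓ² norm `R`.
  set R := ((N + 1 : ℕ) * C + 1) / α with hR
  have hCpos : 0 < C := by positivity
  have hRpos : 0 < R := by positivity
  obtain ⟨φ, hφ⟩ := exists_eq_zero_of_sum_mul_pos
    (f := fun (φ : Primal N) i => -(ε ^ 2 * lap φ i) - Real.exp (-φ i) + ρ i)
    (by unfold lap; fun_prop) hRpos (by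
      intro φ hφ
      have h1 : ∑ i, (-(ε ^ 2 * lap φ i) - Real.exp (-φ i) + ρ i) * φ i
          = ε ^ 2 * ∑ i, grad φ i * grad φ i + ∑ i, (ρ i - Real.exp (-φ i)) * φ i := by
        have := sum_mul_lap φ φ
        rw [← neg_eq_iff_eq_neg] at this
        rw [← this, ← Finset.sum_neg_distrib, Finset.mul_sum, ← Finset.sum_add_distrib]
        exact Finset.sum_congr rfl fun i _ => by ring
      have h2 : 0 ≤ ε ^ 2 * ∑ i, grad φ i * grad φ i :=
        mul_nonneg (sq_nonneg _) (Finset.sum_nonneg fun i _ => mul_self_nonneg _)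
      have h3 : α * ∑ i, |φ i| - (N + 1 : ℕ) * C ≤ ∑ i, (ρ i - Real.exp (-φ i)) * φ i := by
        have : α * ∑ i, |φ i| - (N + 1 : ℕ) * C = ∑ i, (α * |φ i| - C) := by
          rw [Finset.sum_sub_distrib, Finset.mul_sum, Finset.sum_const, Finset.card_univ,
            ZMod.card, nsmul_eq_mul]
        rw [this]
        exact Finset.sum_le_sum fun i _ => hlow i (φ i)
      have h4 : R ≤ ∑ i, |φ i| := by
        refine abs_le_of_sq_le_sq' ?_ (Finset.sum_nonneg fun i _ => abs_nonneg _) |>.2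
        rw [← hφ]
        have := Finset.sum_sq_le_sq_sum_of_nonneg (s := Finset.univ) (f := fun i => |φ i|)
          (fun i _ => abs_nonneg _)
        simpa only [sq_abs] using this
      have h5 : α * R = (N + 1 : ℕ) * C + 1 := by rw [hR]; field_simp
      rw [h1]
      nlinarith [mul_le_mul_of_nonneg_left h4 hα.le])
  refine ⟨φ, fun i => ?_⟩
  have := congrFun hφ i
  simp only [Pi.zero_apply] at this
  linarith

/-- Compare at the maximum of the difference, using e^d ≥ 1 + d. In one direction the lower bound is
needed for e^{-φ₁}, where only `a - δ` is available. -/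
theorem Poisson.sub_le_of_abs_sub_le {N : ℕ} {ε : ℝ} {ρ₁ φ₁ ρ₂ φ₂ : Primal N}
    (h₁ : Poisson ε ρ₁ φ₁) (h₂ : Poisson ε ρ₂ φ₂) {δ a : ℝ} (hδ : ∀ i, |ρ₁ i - ρ₂ i| ≤ δ)
    (ha : ∀ i, a ≤ Real.exp (-φ₂ i)) (hδa : δ < a) (j : ZMod (N + 1)) :
    |φ₁ j - φ₂ j| ≤ δ / (a - δ) := by
  have hδ0 : 0 ≤ δ := (abs_nonneg _).trans (hδ j)
  have hpos : 0 < a - δ := by linarith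
  rw [abs_le]
  constructor
  · obtain ⟨i, hi, hle⟩ := h₂.exists_isMax_sub h₁
    have hd := abs_le.1 (hδ i)
    set d := φ₂ i - φ₁ i with hdd
    have he : Real.exp (-φ₁ i) = Real.exp (-φ₂ i) * Real.exp d := by
      rw [← Real.exp_add]; congr 1; rw [hdd]; ring
    have h1 := Real.add_one_le_exp d
    have h2 : Real.exp (-φ₂ i) * d ≤ δ := by
      nlinarith [mul_le_mul_of_nonneg_left h1 (Real.exp_pos (-φ₂ i)).le]
    have h3 : d ≤ δ / (a - δ) := by
      rcases le_total d 0 with h0 | h0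
      · exact h0.trans (by positivity)
      · rw [le_div_iff₀ hpos]
        nlinarith [mul_le_mul_of_nonneg_right (ha i) h0]
    linarith [hi j]
  · obtain ⟨i, hi, hle⟩ := h₁.exists_isMax_sub h₂
    have hd := abs_le.1 (hδ i)
    set d := φ₁ i - φ₂ i with hdd
    have he : Real.exp (-φ₂ i) = Real.exp (-φ₁ i) * Real.exp d := by
      rw [← Real.exp_add]; congr 1; rw [hdd]; ring
    have h1 := Real.add_one_le_exp d
    have h2 : Real.exp (-φ₁ i) * d ≤ δ := by
      nlinarith [mul_le_mul_of_nonneg_left h1 (Real.exp_pos (-φ₁ i)).le]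
    have h3 : a - δ ≤ Real.exp (-φ₁ i) := by linarith [ha i]
    have h4 : d ≤ δ / (a - δ) := by
      rcases le_total d 0 with h0 | h0
      · exact h0.trans (by positivity)
      · rw [le_div_iff₀ hpos]
        nlinarith [mul_le_mul_of_nonneg_right h3 h0]
    linarith [hi j]

/-- The potential depends continuously on the density. -/
theorem continuous_of_poisson {X : Type*} [TopologicalSpace X] {N : ℕ} {ε : ℝ}
    {ρ φ : X → Primal N} (hρ : Continuous ρ) (h : ∀ x, Poisson ε (ρ x) (φ x)) :
    Continuous φ := by
  rw [continuous_iff_continuousAt]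
  intro x₀
  obtain ⟨k, -, hk⟩ := Finset.exists_min_image Finset.univ (fun i => Real.exp (-φ x₀ i))
    Finset.univ_nonempty
  set a := Real.exp (-φ x₀ k)
  have ha : 0 < a := Real.exp_pos _
  set δ : X → ℝ := fun x => ∑ i, |ρ x i - ρ x₀ i|
  have hδ : Continuous δ := by fun_prop
  have hδ0 : δ x₀ = 0 := by simp [δ]
  have hev : ∀ᶠ x in nhds x₀, δ x < a :=
    hδ.continuousAt.eventually_lt continuousAt_const (by simpa [hδ0] using ha)
  have hlim : Filter.Tendsto (fun x => δ x / (a - δ x)) (nhds x₀) (nhds 0) := by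
    have : ContinuousAt (fun x => δ x / (a - δ x)) x₀ :=
      hδ.continuousAt.div (continuousAt_const.sub hδ.continuousAt) (by simp [hδ0, ha.ne'])
    simpa [ContinuousAt, hδ0] using this
  rw [continuousAt_pi]
  intro j
  rw [ContinuousAt, tendsto_iff_dist_tendsto_zero]
  refine squeeze_zero' (Filter.Eventually.of_forall fun _ => dist_nonneg) ?_ hlim
  filter_upwards [hev] with x hx
  exact (h x).sub_le_of_abs_sub_le (h x₀)
    (fun i => Finset.single_le_sum (f := fun i => |ρ x i - ρ x₀ i|) (fun i _ => abs_nonneg _)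
      (Finset.mem_univ i)) (fun i => hk i (Finset.mem_univ i)) hx j

/-! ### The implicit continuity equation -/

/-- The linear operator of the implicit continuity equation with a given velocity. -/
noncomputable def transport {N : ℕ} (dt : ℝ) (g : ℝ → ℝ) (u : Dual N) :
    Primal N →ₗ[ℝ] Primal N where
  toFun r i := r i / dt + 1 / dx N * (flux g r u i - flux g r u (i - 1))
  map_add' r s := by
    ext i
    simp only [flux, G, Pi.add_apply]
    ring
  map_smul' c r := by
    ext i
    simp only [flux, G, Pi.smul_apply, smul_eq_mul, RingHom.id_apply]
    ring

/-- The matrix form: for `dt > 0` and g(u) ≥ max(u, 0) the diagonal is positive and the other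
coefficients are nonpositive. -/
theorem transport_apply {N : ℕ} (dt : ℝ) (g : ℝ → ℝ) (u : Dual N) (r : Primal N)
    (i : ZMod (N + 1)) : transport dt g u r i
      = r i * (1 / dt + (g (u i) + (g (u (i - 1)) - u (i - 1))) / dx N)
        - (r (i + 1) * (g (u i) - u i) + r (i - 1) * g (u (i - 1))) / dx N := by
  simp only [transport, flux, G, LinearMap.coe_mk, AddHom.coe_mk, sub_add_cancel]
  ring

theorem sum_transport {N : ℕ} (dt : ℝ) (g : ℝ → ℝ) (u : Dual N) (r : Primal N) :
    ∑ i, transport dt g u r i = (∑ i, r i) / dt := by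
  simp only [transport, LinearMap.coe_mk, AddHom.coe_mk, Finset.sum_add_distrib,
    ← Finset.mul_sum, Finset.sum_sub_distrib, sum_shift_sub, sub_self, mul_zero, add_zero,
    ← Finset.sum_div]

section

variable {N : ℕ} {dt : ℝ} {g : ℝ → ℝ}

/-- By the signs of the coefficients, the operator applied to |r| is at most |Tr| pointwise. Summing
cancels the fluxes and leaves only the 1/Δt term. -/
theorem sum_abs_le_transport (hdt : 0 < dt) (hg : ∀ u, max u 0 ≤ g u) (u : Dual N)
    (r : Primal N) : ∑ i, |r i| ≤ dt * ∑ i, |transport dt g u r i| := by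
  have hd := dx_pos N
  have ha : ∀ w, 0 ≤ g w := fun w => (le_max_right _ _).trans (hg w)
  have hb : ∀ w, 0 ≤ g w - w := fun w => sub_nonneg.2 ((le_max_left _ _).trans (hg w))
  have h1 : ∀ i, |r i| * (1 / dt + (g (u i) + (g (u (i - 1)) - u (i - 1))) / dx N)
      - (|r (i + 1)| * (g (u i) - u i) + |r (i - 1)| * g (u (i - 1))) / dx N
      ≤ |transport dt g u r i| := by
    intro i
    have hc : 0 ≤ 1 / dt + (g (u i) + (g (u (i - 1)) - u (i - 1))) / dx N := by
      have := ha (u i)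
      have := hb (u (i - 1))
      positivity
    rw [transport_apply]
    refine le_trans ?_ (abs_sub_abs_le_abs_sub _ _)
    rw [abs_mul, abs_of_nonneg hc, abs_div, abs_of_pos hd]
    gcongr
    refine (abs_add_le _ _).trans ?_
    rw [abs_mul, abs_mul, abs_of_nonneg (hb _), abs_of_nonneg (ha _)]
  have h2 := Finset.sum_le_sum fun i (_ : i ∈ Finset.univ) => h1 i
  have h3 := sum_transport dt g u fun i => |r i|
  simp only [transport_apply] at h3
  rw [h3, div_le_iff₀ hdt] at h2
  linarith

theorem transport_surjective (hdt : 0 < dt) (hg : ∀ u, max u 0 ≤ g u) (u : Dual N) :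
    Function.Surjective (transport dt g u) := by
  refine LinearMap.injective_iff_surjective.1 ((injective_iff_map_eq_zero _).2 fun r hr => ?_)
  have h := sum_abs_le_transport hdt hg u r
  rw [hr] at h
  simp only [Pi.zero_apply, abs_zero, Finset.sum_const_zero, mul_zero] at h
  ext i
  have := Finset.single_le_sum (f := fun i => |r i|) (fun i _ => abs_nonneg _) (Finset.mem_univ i)
  exact abs_nonpos_iff.1 (this.trans h)

/-- Here the ℓ¹ bound reads Σ|r| ≤ Σr, so no entry can be negative. -/
theorem nonneg_of_transport_nonneg (hdt : 0 < dt) (hg : ∀ u, max u 0 ≤ g u) {u : Dual N}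
    {r : Primal N} (h : ∀ i, 0 ≤ transport dt g u r i) (i : ZMod (N + 1)) : 0 ≤ r i := by
  have h1 := sum_abs_le_transport hdt hg u r
  simp only [abs_of_nonneg (h _), sum_transport] at h1
  rw [mul_div_cancel₀ _ hdt.ne', ← sub_nonpos, ← Finset.sum_sub_distrib] at h1
  have h2 := Finset.single_le_sum (f := fun i => |r i| - r i)
    (fun i _ => sub_nonneg.2 (le_abs_self _)) (Finset.mem_univ i)
  exact (abs_nonneg (r i)).trans (by linarith)

/-- Dropping the nonpositive off-diagonal terms bounds the density from below by its source. -/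
theorem transport_le (hdt : 0 < dt) (hg : ∀ u, max u 0 ≤ g u) {u : Dual N}
    {r : Primal N} (h : ∀ i, 0 ≤ transport dt g u r i) (i : ZMod (N + 1)) :
    transport dt g u r i
      ≤ r i * (1 / dt + (g (u i) + (g (u (i - 1)) - u (i - 1))) / dx N) := by
  have hd := dx_pos N
  have h0 := nonneg_of_transport_nonneg hdt hg h
  rw [transport_apply]
  have h1 : 0 ≤ r (i + 1) * (g (u i) - u i) :=
    mul_nonneg (h0 _) (sub_nonneg.2 ((le_max_left _ _).trans (hg _)))
  have h2 : 0 ≤ r (i - 1) * g (u (i - 1)) :=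
    mul_nonneg (h0 _) ((le_max_right _ _).trans (hg _))
  have : 0 ≤ (r (i + 1) * (g (u i) - u i) + r (i - 1) * g (u (i - 1))) / dx N := by positivity
  linarith

theorem pos_of_transport_pos (hdt : 0 < dt) (hg : ∀ u, max u 0 ≤ g u) {u : Dual N}
    {r : Primal N} (h : ∀ i, 0 < transport dt g u r i) (i : ZMod (N + 1)) : 0 < r i := by
  have h1 := (h i).trans_le (transport_le hdt hg (fun j => (h j).le) i)
  exact (nonneg_of_transport_nonneg hdt hg (fun j => (h j).le) i).lt_of_ne'
    fun h0 => by simp [h0] at h1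

/-- The solution of the implicit continuity equation depends continuously on the velocity. -/
theorem continuous_of_transport_eq (hdt : 0 < dt) (hg : ∀ u, max u 0 ≤ g u)
    (hgc : Continuous g) {r : Dual N → Primal N} {s : Primal N}
    (h : ∀ u, transport dt g u (r u) = s) : Continuous r := by
  rw [continuous_iff_continuousAt]
  intro v
  have hcont : Continuous fun u => dt * ∑ i, |s i - transport dt g u (r v) i| := by
    simp only [transport_apply]
    fun_prop
  have hlim := hcont.tendsto v
  rw [h v] at hlim
  simp only [sub_self, abs_zero, Finset.sum_const_zero, mul_zero] at hlim
  rw [continuousAt_pi]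
  intro j
  rw [ContinuousAt, tendsto_iff_dist_tendsto_zero]
  refine squeeze_zero (fun _ => dist_nonneg) (fun u => ?_) hlim
  -- The operator at `u` sends r(u) - r(v) to the residual of the fixed density r(v), which is
  -- continuous in `u` and vanishes at `v`.
  have h1 := sum_abs_le_transport hdt hg u (r u - r v)
  rw [map_sub, h u] at h1
  exact (Finset.single_le_sum (f := fun i => |(r u - r v) i|) (fun i _ => abs_nonneg _)
    (Finset.mem_univ j)).trans h1

end

/-! ### The energy balance -/

/-- The residual of the discrete momentum equation. -/
noncomputable def momentumResidual {N : ℕ} (dt : ℝ) (g : ℝ → ℝ) (ρ : Primal N) (u : Dual N)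
    (ρ' : Primal N) (u' : Dual N) (φ' : Primal N) : Dual N := fun i =>
  (rhoDual ρ' i * u' i - rhoDual ρ i * u i) / dt
    + 1 / dx N * (fluxPrimal g ρ' u' (i + 1) * uPrimal g ρ' u' (i + 1)
        - fluxPrimal g ρ' u' i * uPrimal g ρ' u' i)
    - rhoTilde g ρ' u' i * grad φ' i

/-- Upwinding makes each flux term either vanish or have the favourable sign. -/
theorem kinDissipation_nonneg {N : ℕ} {dt : ℝ} (hdt : 0 < dt) (g : ℝ → ℝ) {ρ : Primal N}
    (hρ : ∀ i, 0 ≤ ρ i) (u : Dual N) (ρ' : Primal N) (u' : Dual N) (i : ZMod (N + 1)) :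
    0 ≤ kinDissipation dt g ρ u ρ' u' i := by
  have hd := dx_pos N
  have h1 : 0 ≤ -(fluxPrimal g ρ' u' (i + 1)
      * ((uPrimal g ρ' u' (i + 1) - u' i) ^ 2 / (2 * dx N))) := by
    by_cases h : 0 ≤ fluxPrimal g ρ' u' (i + 1)
    · simp [uPrimal, h]
    · have : 0 ≤ (uPrimal g ρ' u' (i + 1) - u' i) ^ 2 / (2 * dx N) := by positivity
      nlinarith
  have h2 : 0 ≤ fluxPrimal g ρ' u' i * ((uPrimal g ρ' u' i - u' i) ^ 2 / (2 * dx N)) := by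
    by_cases h : 0 ≤ fluxPrimal g ρ' u' i
    · positivity
    · simp [uPrimal, h]
  have h3 : 0 ≤ rhoDual ρ i := by
    have := hρ i
    have := hρ (i + 1)
    unfold rhoDual
    positivity
  unfold kinDissipation
  have : 0 ≤ rhoDual ρ i * ((u i - u' i) ^ 2 / (2 * dt)) := by positivity
  linarith

theorem dissipation_nonneg {N : ℕ} {dt : ℝ} (hdt : 0 < dt) (ε : ℝ) {g : ℝ → ℝ} (hg : 0 ≤ g 0)
    {ρ : Primal N} (hρ : ∀ i, 0 ≤ ρ i) (u : Dual N) (φ ρ' : Primal N) (u' : Dual N)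
    (φ' ξ : Primal N) : 0 ≤ dissipation ε dt g ρ u φ ρ' u' φ' ξ := by
  have hd := dx_pos N
  have hk := kinDissipation_nonneg hdt g hρ u ρ' u'
  unfold dissipation
  have h1 : 0 ≤ ∑ i, (kinDissipation dt g ρ u ρ' u' i
      + Real.exp (-ξ i) * ((φ' i - φ i) ^ 2 / (2 * dt))) * dx N :=
    Finset.sum_nonneg fun i _ => mul_nonneg (add_nonneg (hk i) (by positivity)) hd.le
  positivity

/-- The purpose of `rhoTilde`: the work of the force is the mass flux against the potential
gradient, plus a diffusion weighted by g(0). -/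
theorem rhoTilde_mul {N : ℕ} (g : ℝ → ℝ) (ρ : Primal N) (u : Dual N) (i : ZMod (N + 1)) :
    rhoTilde g ρ u i * u i = flux g ρ u i + g 0 * (ρ (i + 1) - ρ i) := by
  by_cases h : u i = 0
  · simp [h, flux, G]; ring
  · simp only [rhoTilde, flux, G, ne_eq, h, not_false_eq_true, if_true, sub_zero]
    field_simp
    ring

section

variable {N : ℕ} {ε dt : ℝ} {g : ℝ → ℝ} {ρ φ ρ' φ' : Primal N} {u u' : Dual N}

/-- The kinetic energy balance. -/
theorem kinetic_balance
    (hc : ∀ i, (ρ' i - ρ i) / dt + 1 / dx N * (flux g ρ' u' i - flux g ρ' u' (i - 1)) = 0) :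
    ∑ i, ((rhoDual ρ' i * u' i - rhoDual ρ i * u i) / dt
      + 1 / dx N * (fluxPrimal g ρ' u' (i + 1) * uPrimal g ρ' u' (i + 1)
          - fluxPrimal g ρ' u' i * uPrimal g ρ' u' i)) * u' i
      = (∑ i, rhoDual ρ' i * (u' i ^ 2 / 2) - ∑ i, rhoDual ρ i * (u i ^ 2 / 2)) / dt
        + ∑ i, kinDissipation dt g ρ u ρ' u' i := by
  set F := fluxPrimal g ρ' u' with hF
  set w := uPrimal g ρ' u'
  -- Averaging the continuity equation over two neighbouring cells gives a mass balance on the dual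
  -- mesh.
  have hdual : ∀ i, (rhoDual ρ' i - rhoDual ρ i) / dt + 1 / dx N * (F (i + 1) - F i) = 0 := by
    intro i
    have h1 := hc i
    have h2 := hc (i + 1)
    simp only [add_sub_cancel_right] at h2
    simp only [rhoDual, hF, fluxPrimal, add_sub_cancel_right]
    linear_combination (h1 + h2) / 2
  have hpt : ∀ i, ((rhoDual ρ' i * u' i - rhoDual ρ i * u i) / dt
      + 1 / dx N * (F (i + 1) * w (i + 1) - F i * w i)) * u' i
      = (rhoDual ρ' i * (u' i ^ 2 / 2) - rhoDual ρ i * (u i ^ 2 / 2)) / dt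
        + kinDissipation dt g ρ u ρ' u' i
        + (F (i + 1) * w (i + 1) ^ 2 / (2 * dx N) - F i * w i ^ 2 / (2 * dx N)) := by
    intro i
    simp only [kinDissipation]
    linear_combination (u' i ^ 2 / 2) * hdual i
  rw [Finset.sum_congr rfl fun i _ => hpt i, Finset.sum_add_distrib, Finset.sum_add_distrib,
    Finset.sum_sub_distrib, sum_shift fun i => F i * w i ^ 2 / (2 * dx N), sub_self, add_zero,
    ← Finset.sum_div, Finset.sum_sub_distrib]

/-- The potential energy balance. -/
theorem potential_balance (hφ : Poisson ε ρ φ) (hφ' : Poisson ε ρ' φ')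
    (hc : ∀ i, (ρ' i - ρ i) / dt + 1 / dx N * (flux g ρ' u' i - flux g ρ' u' (i - 1)) = 0)
    {ξ : Primal N} (hξ : ∀ i, Real.exp (-φ' i) = Real.exp (-φ i)
      - Real.exp (-φ i) * (φ' i - φ i) + Real.exp (-ξ i) * ((φ' i - φ i) ^ 2 / 2)) :
    -∑ i, rhoTilde g ρ' u' i * grad φ' i * u' i
      = ((∑ i, (ε ^ 2 / 2 * grad φ' i ^ 2 + h (φ' i)))
          - ∑ i, (ε ^ 2 / 2 * grad φ i ^ 2 + h (φ i))) / dt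
        + ∑ i, Real.exp (-ξ i) * ((φ' i - φ i) ^ 2 / (2 * dt))
        + ε ^ 2 / (2 * dt) * ∑ i, (grad φ' i - grad φ i) ^ 2
        + g 0 / dx N * ∑ i, ε ^ 2 * (grad φ' i - grad φ' (i - 1)) ^ 2
        + g 0 / dx N *
          ∑ i, |(Real.exp (-φ' i) - Real.exp (-φ' (i - 1))) * (φ' i - φ' (i - 1))| := by
  have hd := (dx_pos N).ne'
  -- the flux term
  have h1 : ∑ i, flux g ρ' u' i * grad φ' i = (∑ i, φ' i * (ρ' i - ρ i)) / dt := by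
    have e1 := sum_mul_sub_eq_neg φ' (flux g ρ' u')
    have e2 : ∀ i, φ' i * (flux g ρ' u' i - flux g ρ' u' (i - 1))
        = -(dx N * (φ' i * (ρ' i - ρ i) / dt)) := by
      intro i
      have := hc i
      field_simp at this ⊢
      linear_combination φ' i * this
    rw [Finset.sum_congr rfl fun i _ => e2 i, Finset.sum_neg_distrib, neg_inj, ← Finset.mul_sum,
      ← Finset.sum_div] at e1
    have e3 : ∑ i, flux g ρ' u' i * grad φ' i
        = (∑ i, (φ' (i + 1) - φ' i) * flux g ρ' u' i) / dx N := by
      rw [Finset.sum_div]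
      exact Finset.sum_congr rfl fun i _ => by simp only [grad]; ring
    rw [e3, ← e1]
    field_simp
  -- the change of the density
  have h2 : ∑ i, φ' i * (ρ' i - ρ i)
      = -(ε ^ 2 * ∑ i, grad φ' i * (grad φ' i - grad φ i))
        + ∑ i, φ' i * (Real.exp (-φ' i) - Real.exp (-φ i)) := by
    simp only [mul_sub, Finset.sum_sub_distrib]
    rw [hφ.sum_mul, hφ'.sum_mul]
    ring
  -- As h'(s) = s e^{-s}, the error in this discrete chain rule is exactly the Taylor remainder of
  -- e^{-s} at φ.
  have h3 : ∑ i, φ' i * (Real.exp (-φ' i) - Real.exp (-φ i))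
      = -(∑ i, h (φ' i) - ∑ i, h (φ i)) - ∑ i, Real.exp (-ξ i) * ((φ' i - φ i) ^ 2 / 2) := by
    rw [← Finset.sum_sub_distrib, ← Finset.sum_neg_distrib, ← Finset.sum_sub_distrib]
    refine Finset.sum_congr rfl fun i _ => ?_
    simp only [h]
    linear_combination -hξ i
  have h4 : ∑ i, grad φ' i * (grad φ' i - grad φ i)
      = (∑ i, grad φ' i ^ 2 - ∑ i, grad φ i ^ 2) / 2
        + (∑ i, (grad φ' i - grad φ i) ^ 2) / 2 := by
    rw [← Finset.sum_sub_distrib, Finset.sum_div, Finset.sum_div, ← Finset.sum_add_distrib]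
    exact Finset.sum_congr rfl fun i _ => by ring
  -- the numerical diffusion
  have h5 : ∑ i, (ρ' (i + 1) - ρ' i) * grad φ' i
      = -((∑ i, ε ^ 2 * (grad φ' i - grad φ' (i - 1)) ^ 2) / dx N
        + (∑ i, |(Real.exp (-φ' i) - Real.exp (-φ' (i - 1))) * (φ' i - φ' (i - 1))|) / dx N) := by
    have e1 := sum_mul_sub_eq_neg ρ' (grad φ')
    have e2 : ∀ i, ρ' i * (grad φ' i - grad φ' (i - 1))
        = ε ^ 2 * (grad φ' i - grad φ' (i - 1)) ^ 2 / dx N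
          + Real.exp (-φ' i) * (grad φ' i - grad φ' (i - 1)) := by
      intro i
      rw [← hφ' i, lap_eq]
      ring
    have e3 := sum_mul_sub_eq_neg (fun i => Real.exp (-φ' i)) (grad φ')
    have e4 : ∑ i, |(Real.exp (-φ' i) - Real.exp (-φ' (i - 1))) * (φ' i - φ' (i - 1))|
        = -(dx N * ∑ i, (Real.exp (-φ' (i + 1)) - Real.exp (-φ' i)) * grad φ' i) := by
      have e5 := sum_shift fun i =>
        |(Real.exp (-φ' i) - Real.exp (-φ' (i - 1))) * (φ' i - φ' (i - 1))|
      rw [← e5, Finset.mul_sum, ← Finset.sum_neg_distrib]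
      refine Finset.sum_congr rfl fun i _ => ?_
      simp only [add_sub_cancel_right]
      rw [abs_of_nonpos]
      · simp only [grad]
        field_simp
      · have := sub_mul_exp_sub_exp_nonpos zero_le_one (φ' (i + 1)) (φ' i)
        simp only [neg_mul, one_mul] at this
        linarith
    rw [Finset.sum_congr rfl fun i _ => e2 i, Finset.sum_add_distrib, e3, ← Finset.sum_div] at e1
    rw [e4]
    field_simp at e1 ⊢
    linear_combination e1
  have h6 : ∑ i, rhoTilde g ρ' u' i * grad φ' i * u' i
      = ∑ i, flux g ρ' u' i * grad φ' i + g 0 * ∑ i, (ρ' (i + 1) - ρ' i) * grad φ' i := by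
    rw [Finset.mul_sum, ← Finset.sum_add_distrib]
    refine Finset.sum_congr rfl fun i _ => ?_
    linear_combination grad φ' i * rhoTilde_mul g ρ' u' i
  have h7 : ∑ i, Real.exp (-ξ i) * ((φ' i - φ i) ^ 2 / (2 * dt))
      = (∑ i, Real.exp (-ξ i) * ((φ' i - φ i) ^ 2 / 2)) / dt := by
    rw [Finset.sum_div]
    exact Finset.sum_congr rfl fun i _ => by ring
  have h8 : ∀ ψ : Primal N, ∑ i, (ε ^ 2 / 2 * grad ψ i ^ 2 + h (ψ i))
      = ε ^ 2 / 2 * ∑ i, grad ψ i ^ 2 + ∑ i, h (ψ i) := fun ψ => by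
    rw [Finset.sum_add_distrib, Finset.mul_sum]
  rw [h6, h1, h2, h3, h4, h5, h7, h8, h8]
  ring

theorem energy_eq (ε : ℝ) (ρ : Primal N) (u : Dual N) (φ : Primal N) :
    energy ε ρ u φ = (∑ i, rhoDual ρ i * (u i ^ 2 / 2)
      + ∑ i, (ε ^ 2 / 2 * grad φ i ^ 2 + h (φ i))) * dx N := by
  rw [energy, ← Finset.sum_add_distrib, Finset.sum_mul]
  exact Finset.sum_congr rfl fun i _ => by rw [sq_abs, grad]; ring

/-- The total energy balance, with the momentum residual as a source. -/
theorem energy_balance (hφ : Poisson ε ρ φ) (hφ' : Poisson ε ρ' φ')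
    (hc : ∀ i, (ρ' i - ρ i) / dt + 1 / dx N * (flux g ρ' u' i - flux g ρ' u' (i - 1)) = 0)
    {ξ : Primal N} (hξ : ∀ i, Real.exp (-φ' i) = Real.exp (-φ i)
      - Real.exp (-φ i) * (φ' i - φ i) + Real.exp (-ξ i) * ((φ' i - φ i) ^ 2 / 2)) :
    (∑ i, momentumResidual dt g ρ u ρ' u' φ' i * u' i) * dx N
      = (energy ε ρ' u' φ' - energy ε ρ u φ) / dt + dissipation ε dt g ρ u φ ρ' u' φ' ξ := by
  have h1 := kinetic_balance (u := u) hc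
  have h2 := potential_balance hφ hφ' hc hξ
  have h3 : ∑ i, momentumResidual dt g ρ u ρ' u' φ' i * u' i
      = ∑ i, ((rhoDual ρ' i * u' i - rhoDual ρ i * u i) / dt
      + 1 / dx N * (fluxPrimal g ρ' u' (i + 1) * uPrimal g ρ' u' (i + 1)
          - fluxPrimal g ρ' u' i * uPrimal g ρ' u' i)) * u' i
        + -∑ i, rhoTilde g ρ' u' i * grad φ' i * u' i := by
    rw [← Finset.sum_neg_distrib, ← Finset.sum_add_distrib]
    exact Finset.sum_congr rfl fun i _ => by simp only [momentumResidual]; ring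
  have h4 : dissipation ε dt g ρ u φ ρ' u' φ' ξ
      = (∑ i, kinDissipation dt g ρ u ρ' u' i
        + ∑ i, Real.exp (-ξ i) * ((φ' i - φ i) ^ 2 / (2 * dt))
        + ε ^ 2 / (2 * dt) * ∑ i, (grad φ' i - grad φ i) ^ 2
        + g 0 / dx N * ∑ i, ε ^ 2 * (grad φ' i - grad φ' (i - 1)) ^ 2
        + g 0 / dx N *
          ∑ i, |(Real.exp (-φ' i) - Real.exp (-φ' (i - 1))) * (φ' i - φ' (i - 1))|) * dx N := by
    simp only [dissipation, sq_abs, ← Finset.sum_mul, Finset.sum_add_distrib, grad]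
    ring
  rw [h3, h1, h2, h4, energy_eq, energy_eq]
  ring

end

/-- Taylor's formula of second order for `s ↦ exp (-s)`. -/
theorem exists_exp_neg_taylor (a b : ℝ) :
    ∃ ξ, (a = b → ξ = a) ∧ (a ≠ b → ξ ∈ Set.Ioo (min a b) (max a b)) ∧
      Real.exp (-b) = Real.exp (-a) - Real.exp (-a) * (b - a)
        + Real.exp (-ξ) * ((b - a) ^ 2 / 2) := by
  by_cases hab : a = b
  · exact ⟨a, fun _ => rfl, fun hne => absurd hab hne, by simp [hab]⟩
  · have hd : ∀ (c : ℝ) (t : ℝ), HasDerivAt (fun s => c * Real.exp (-s)) (-c * Real.exp (-t)) t :=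
      fun c t => by simpa using ((hasDerivAt_neg t).exp).const_mul c
    obtain ⟨ξ, hξ, h⟩ := taylor_mean_remainder_lagrange_iteratedDeriv (n := 1)
      (f := fun s => Real.exp (-s)) hab (by fun_prop)
    refine ⟨ξ, fun h' => absurd h' hab, fun _ => hξ, ?_⟩
    have hd1 : deriv (fun s : ℝ => Real.exp (-s)) = fun s => -1 * Real.exp (-s) := by
      ext t
      have := (hd 1 t).deriv
      simpa using this
    have h2 : iteratedDeriv 2 (fun s : ℝ => Real.exp (-s)) ξ = Real.exp (-ξ) := by
      rw [iteratedDeriv_succ, iteratedDeriv_one, hd1, (hd (-1) ξ).deriv]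
      ring
    have h1 : derivWithin (fun s : ℝ => Real.exp (-s)) (Set.uIcc a b) a
        = -1 * Real.exp (-a) := by
      have := (hd 1 a).hasDerivWithinAt (s := Set.uIcc a b)
      simp only [one_mul] at this
      exact this.derivWithin (uniqueDiffOn_uIcc hab a Set.left_mem_uIcc)
    simp only [taylorWithinEval_succ, taylor_within_zero_eval, one_add_one_eq_two, h2] at h
    norm_num [Nat.factorial] at h
    rw [h1] at h
    linarith

/-! ### Solvability of a time step -/

theorem neg_one_le_h (s : ℝ) : -1 ≤ h s := by
  have h1 := Real.add_one_le_exp s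
  have h2 : Real.exp s * Real.exp (-s) = 1 := by rw [← Real.exp_add]; simp
  unfold h
  nlinarith [Real.exp_pos (-s)]

theorem sum_kinetic_sub_one_le_energy {N : ℕ} (ε : ℝ) (ρ : Primal N) (u : Dual N)
    (φ : Primal N) : (∑ i, rhoDual ρ i * (u i ^ 2 / 2)) * dx N - 1 ≤ energy ε ρ u φ := by
  have hd := dx_pos N
  rw [← sum_dx N, Finset.sum_mul, ← Finset.sum_sub_distrib]
  refine Finset.sum_le_sum fun i _ => ?_
  have h1 := neg_one_le_h (φ i)
  have h2 : 0 ≤ ε ^ 2 / 2 * |(φ (i + 1) - φ i) / dx N| ^ 2 := by positivity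
  nlinarith

/-- Shows that the momentum flux is continuous although the upwind velocity jumps: the jump occurs
where the flux vanishes. -/
theorem fluxPrimal_mul_uPrimal {N : ℕ} (g : ℝ → ℝ) (ρ : Primal N) (u : Dual N)
    (i : ZMod (N + 1)) : fluxPrimal g ρ u i * uPrimal g ρ u i
      = max (fluxPrimal g ρ u i) 0 * u (i - 1) + min (fluxPrimal g ρ u i) 0 * u i := by
  by_cases h : 0 ≤ fluxPrimal g ρ u i
  · simp [uPrimal, h]
  · simp [uPrimal, h, (not_le.1 h).le]

theorem rhoTilde_eq_dslope {N : ℕ} (g : ℝ → ℝ) (ρ : Primal N) (u : Dual N)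
    (i : ZMod (N + 1)) :
    rhoTilde g ρ u i = ρ i * dslope g 0 (u i) - ρ (i + 1) * (dslope g 0 (u i) - 1) := by
  by_cases h : u i = 0
  · simp [rhoTilde, h]; ring
  · rw [dslope_of_ne _ h, slope_def_field]
    simp only [rhoTilde, G, ne_eq, h, not_false_eq_true, if_true, sub_zero]
    field_simp
    ring

theorem continuous_dslope_of_differentiableAt {g : ℝ → ℝ} {a : ℝ} (hg : Continuous g)
    (hd : DifferentiableAt ℝ g a) : Continuous (dslope g a) := by
  rw [← continuousOn_univ]
  exact (continuousOn_dslope Filter.univ_mem).2 ⟨hg.continuousOn, hd⟩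

theorem continuous_momentumResidual {N : ℕ} (dt : ℝ) {g : ℝ → ℝ} (hg : Continuous g)
    (hd : DifferentiableAt ℝ g 0) (ρ : Primal N) (u : Dual N) {r φ : Dual N → Primal N}
    (hr : Continuous r) (hφ : Continuous φ) :
    Continuous fun w => momentumResidual dt g ρ u (r w) w (φ w) := by
  have hs := continuous_dslope_of_differentiableAt hg hd
  have hF : ∀ i, Continuous fun w => fluxPrimal g (r w) w i := by
    intro i
    unfold fluxPrimal flux G
    fun_prop
  have hFu : ∀ i, Continuous fun w => fluxPrimal g (r w) w i * uPrimal g (r w) w i := by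
    intro i
    simp only [fluxPrimal_mul_uPrimal]
    exact (((hF i).max continuous_const).mul (continuous_apply _)).add
      (((hF i).min continuous_const).mul (continuous_apply _))
  refine continuous_pi fun i => ?_
  have hFi := hFu i
  have hFi' := hFu (i + 1)
  have hT : Continuous fun w => rhoTilde g (r w) w i * grad (φ w) i := by
    simp only [rhoTilde_eq_dslope, grad]
    fun_prop
  have hD : Continuous fun w => (rhoDual (r w) i * w i - rhoDual ρ i * u i) / dt := by
    unfold rhoDual
    fun_prop
  exact (hD.add (continuous_const.mul (hFi'.sub hFi))).sub hT

section

variable {N : ℕ} {ε dt : ℝ} {g : ℝ → ℝ}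

/-- The kinetic energy of the transported density grows at least linearly in the velocity. -/
theorem mul_le_sum_kinetic_of_transport (hdt : 0 < dt) (hg : ∀ u, max u 0 ≤ g u) {K : ℝ≥0}
    (hK : LipschitzWith K g) {ρ r : Primal N} {m : ℝ} (hm : 0 < m) (hρ : ∀ i, m ≤ ρ i)
    {u : Dual N} (hr : transport dt g u r = fun i => ρ i / dt) {U : ℝ} (hU : 1 ≤ U)
    (hle : ∀ i, |u i| ≤ U) {k : ZMod (N + 1)} (hk : |u k| = U) :
    m / dt / (1 / dt + (2 * g 0 + (2 * K + 1)) / dx N) * U / 2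
      ≤ ∑ i, rhoDual r i * (u i ^ 2 / 2) := by
  have hd := dx_pos N
  have hg0 : 0 ≤ g 0 := (le_max_right _ _).trans (hg 0)
  have hK0 : (0 : ℝ) ≤ K := K.2
  have hnn : ∀ i, 0 ≤ transport dt g u r i := fun i => by
    rw [hr]
    exact div_nonneg (hm.le.trans (hρ i)) hdt.le
  set c := 1 / dt + (2 * g 0 + (2 * K + 1)) / dx N with hc
  have hc0 : 0 < c := by positivity
  have hgle : ∀ w, |w| ≤ U → g w ≤ g 0 + K * U := by
    intro w hw
    have h1 := hK.dist_le_mul w 0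
    rw [Real.dist_eq, dist_zero_right, Real.norm_eq_abs] at h1
    have h2 := le_abs_self (g w - g 0)
    nlinarith [mul_le_mul_of_nonneg_left hw hK0]
  -- The Lipschitz bound on `g` makes the diagonal coefficient at most c U, so the density decays no
  -- faster than 1/U.
  have hrlow : ∀ i, m / dt / c / U ≤ r i := by
    intro i
    have h0 := nonneg_of_transport_nonneg hdt hg hnn i
    have h1 := transport_le hdt hg hnn i
    rw [hr] at h1
    have h2 : 1 / dt + (g (u i) + (g (u (i - 1)) - u (i - 1))) / dx N ≤ c * U := by
      have h3 := hgle _ (hle i)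
      have h4 := hgle _ (hle (i - 1))
      have h5 := (neg_le_abs (u (i - 1))).trans (hle (i - 1))
      have h6 : g (u i) + (g (u (i - 1)) - u (i - 1)) ≤ (2 * g 0 + (2 * K + 1)) * U := by
        nlinarith
      have h7 := div_le_div_of_nonneg_right h6 hd.le
      have h8 : 1 / dt ≤ 1 / dt * U := le_mul_of_one_le_right (by positivity) hU
      calc _ ≤ 1 / dt * U + (2 * g 0 + (2 * K + 1)) * U / dx N := add_le_add h8 h7
        _ = c * U := by rw [hc]; ring
    have h9 : m / dt ≤ r i * (c * U) :=
      (div_le_div_of_nonneg_right (hρ i) hdt.le).trans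
        (h1.trans (mul_le_mul_of_nonneg_left h2 h0))
    rw [div_div, div_le_iff₀ (by positivity)]
    exact h9
  have hlow0 : 0 < m / dt / c / U := by positivity
  have hdual : ∀ i, m / dt / c / U ≤ rhoDual r i := fun i => by
    unfold rhoDual
    linarith [hrlow i, hrlow (i + 1)]
  have h1 : rhoDual r k * (u k ^ 2 / 2) ≤ ∑ i, rhoDual r i * (u i ^ 2 / 2) :=
    Finset.single_le_sum (f := fun i => rhoDual r i * (u i ^ 2 / 2))
      (fun i _ => mul_nonneg (hlow0.le.trans (hdual i)) (by positivity)) (Finset.mem_univ k)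
  refine le_trans ?_ h1
  rw [← sq_abs, hk]
  calc m / dt / c * U / 2 = m / dt / c / U * (U ^ 2 / 2) := by field_simp
    _ ≤ _ := mul_le_mul_of_nonneg_right (hdual k) (by positivity)

/-- The fully implicit scheme is solvable, with a positive density. -/
theorem exists_step (hdt : 0 < dt) (hg : ∀ u, max u 0 ≤ g u) {K : ℝ≥0}
    (hK : LipschitzWith K g) (hgd : DifferentiableAt ℝ g 0) {ρ φ : Primal N} (u : Dual N)
    (hρ : ∀ i, 0 < ρ i) (hφ : Poisson ε ρ φ) :
    ∃ (ρ' : Primal N) (u' : Dual N) (φ' : Primal N),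
      Step ε dt g ρ u ρ' u' φ' ∧ ∀ i, 0 < ρ' i := by
  have hd := dx_pos N
  have hg0 : 0 ≤ g 0 := (le_max_right _ _).trans (hg 0)
  choose r hr using fun w => transport_surjective hdt hg w fun i : ZMod (N + 1) => ρ i / dt
  have hrpos : ∀ w i, 0 < r w i := fun w => pos_of_transport_pos hdt hg fun i => by
    rw [hr]
    exact div_pos (hρ i) hdt
  have hrc : Continuous r := continuous_of_transport_eq hdt hg hK.continuous hr
  choose Φ hΦ using fun w => exists_poisson ε (hrpos w)
  have hΦc : Continuous Φ := continuous_of_poisson hrc hΦ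
  have hcont : ∀ w i, (r w i - ρ i) / dt
      + 1 / dx N * (flux g (r w) w i - flux g (r w) w (i - 1)) = 0 := by
    intro w i
    have := congrFun (hr w) i
    simp only [transport, LinearMap.coe_mk, AddHom.coe_mk] at this
    rw [sub_div]
    linarith
  set m := Real.exp (minLog ρ)
  have hm : 0 < m := Real.exp_pos _
  set c := m / dt / (1 / dt + (2 * g 0 + (2 * K + 1)) / dx N) with hc
  have hc0 : 0 < c := by positivity
  -- From this speed on the kinetic energy is at least |E| + 2, with E the old energy; as h ≥ -1 on
  -- a torus of length 1, the new energy exceeds E.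
  set U₀ := max 1 (2 * (|energy ε ρ u φ| + 2) / (c * dx N)) with hU₀
  have hU₀1 : 1 ≤ U₀ := le_max_left _ _
  have hU₀E : |energy ε ρ u φ| + 2 ≤ c * U₀ / 2 * dx N := by
    have := le_max_right 1 (2 * (|energy ε ρ u φ| + 2) / (c * dx N))
    rw [← hU₀, div_le_iff₀ (by positivity)] at this
    linarith
  -- On the sphere of radius (N + 1)U₀ some component has modulus at least U₀.
  obtain ⟨w, hw⟩ := exists_eq_zero_of_sum_mul_pos (R := (N + 1) * U₀)
    (continuous_momentumResidual dt hK.continuous hgd ρ u hrc hΦc) (by positivity) (by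
      intro w hw
      obtain ⟨k, -, hk⟩ := Finset.exists_max_image Finset.univ (fun i => |w i|)
        Finset.univ_nonempty
      replace hk : ∀ i, |w i| ≤ |w k| := fun i => hk i (Finset.mem_univ i)
      have hUk : U₀ ≤ |w k| := by
        have h1 : ∑ i, w i ^ 2 ≤ (N + 1) * |w k| ^ 2 := by
          have : ∑ i, w i ^ 2 ≤ ∑ _i : ZMod (N + 1), |w k| ^ 2 :=
            Finset.sum_le_sum fun i _ => by
              rw [← sq_abs]
              exact pow_le_pow_left₀ (abs_nonneg _) (hk i) 2
          rw [Finset.sum_const, Finset.card_univ, ZMod.card, nsmul_eq_mul] at this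
          push_cast at this
          exact this
        rw [hw, mul_pow, sq ((N : ℝ) + 1), mul_assoc] at h1
        have h2 := le_of_mul_le_mul_left h1 (by positivity)
        have h3 : U₀ ^ 2 ≤ |w k| ^ 2 :=
          le_trans (le_mul_of_one_le_left (sq_nonneg _) (by
            linarith [Nat.cast_nonneg (α := ℝ) N])) h2
        exact abs_le_of_sq_le_sq' h3 (abs_nonneg _) |>.2
      have hkin := mul_le_sum_kinetic_of_transport hdt hg hK hm (exp_minLog_le hρ) (hr w)
        (hU₀1.trans hUk) hk rfl
      rw [← hc] at hkin
      have hen := sum_kinetic_sub_one_le_energy ε (r w) w (Φ w)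
      have h1 : c * U₀ / 2 * dx N ≤ (∑ i, rhoDual (r w) i * (w i ^ 2 / 2)) * dx N := by
        refine mul_le_mul_of_nonneg_right (le_trans ?_ hkin) hd.le
        have := mul_le_mul_of_nonneg_left hUk hc0.le
        linarith
      have h2 : energy ε ρ u φ < energy ε (r w) w (Φ w) := by
        linarith [le_abs_self (energy ε ρ u φ)]
      choose ξ hξ using fun i => exists_exp_neg_taylor (φ i) (Φ w i)
      have hbal := energy_balance (u := u) hφ (hΦ w) (hcont w) fun i => (hξ i).2.2
      have hdis := dissipation_nonneg hdt ε hg0 (fun i => (hρ i).le) u φ (r w) w (Φ w) ξ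
      have h3 : 0 < (energy ε (r w) w (Φ w) - energy ε ρ u φ) / dt :=
        div_pos (sub_pos.2 h2) hdt
      exact pos_of_mul_pos_left (by rw [hbal]; linarith) hd.le)
  exact ⟨r w, w, Φ w, ⟨hcont w, fun i => sub_eq_zero.1 (congrFun hw i), hΦ w⟩, hrpos w⟩

theorem Step.lpNorm_one_eq {ρ ρ' φ' : Primal N} {u u' : Dual N} (hdt : 0 < dt)
    (hs : Step ε dt g ρ u ρ' u' φ') (hρ : ∀ i, 0 < ρ i) (hρ' : ∀ i, 0 < ρ' i) :
    lpNorm 1 ρ' = lpNorm 1 ρ := by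
  rw [lpNorm_one_of_nonneg fun i => (hρ i).le, lpNorm_one_of_nonneg fun i => (hρ' i).le,
    ← Finset.sum_mul, ← Finset.sum_mul]
  have h1 := Finset.sum_congr rfl fun i (_ : i ∈ Finset.univ) => hs.continuity i
  rw [Finset.sum_add_distrib, ← Finset.mul_sum, Finset.sum_sub_distrib, sum_shift_sub, sub_self,
    mul_zero, add_zero, ← Finset.sum_div, Finset.sum_sub_distrib, Finset.sum_const_zero,
    div_eq_zero_iff, or_iff_left hdt.ne', sub_eq_zero] at h1
  rw [h1]

theorem Step.energy_add {ρ φ ρ' φ' ξ : Primal N} {u u' : Dual N} (hdt : 0 < dt)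
    (hφ : Poisson ε ρ φ) (hs : Step ε dt g ρ u ρ' u' φ')
    (hξ : ∀ i, Real.exp (-φ' i) = Real.exp (-φ i)
      - Real.exp (-φ i) * (φ' i - φ i) + Real.exp (-ξ i) * ((φ' i - φ i) ^ 2 / 2)) :
    energy ε ρ' u' φ' + dt * dissipation ε dt g ρ u φ ρ' u' φ' ξ = energy ε ρ u φ := by
  have h1 := energy_balance (u := u) hφ hs.poisson hs.continuity hξ
  have h2 : ∑ i, momentumResidual dt g ρ u ρ' u' φ' i * u' i = 0 :=
    Finset.sum_eq_zero fun i _ => by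
      rw [momentumResidual, sub_eq_zero.2 (hs.momentum i), zero_mul]
  rw [h2, zero_mul] at h1
  field_simp at h1
  linarith

end

end EPB

/-! ### Iteration of the time step and the main theorem. -/

theorem theorem1 (N NT : ℕ) (hN : 1 ≤ N) (hNT : 1 ≤ NT)
    (ε T : ℝ) (hε : 0 < ε) (hT : 0 < T)
    (g : ℝ → ℝ) (hg_lip : ∃ K : ℝ≥0, LipschitzWith K g)
    (hg_lower : ∀ u : ℝ, max u 0 ≤ g u) (hg_diff : DifferentiableAt ℝ g 0)
    (dt : ℝ) (hdt : dt = T / (NT : ℝ))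
    (ρ₀ : EPB.Primal N) (u₀ : EPB.Dual N) (φ₀ : EPB.Primal N)
    (hρ₀ : ∀ i, 0 < ρ₀ i) (hφ₀ : EPB.Poisson ε ρ₀ φ₀) :
    ∃ (ρ : ℕ → EPB.Primal N) (u : ℕ → EPB.Dual N) (φ : ℕ → EPB.Primal N),
      (ρ 0 = ρ₀ ∧ u 0 = u₀ ∧ φ 0 = φ₀) ∧
      (∀ n < NT, EPB.Step ε dt g (ρ n) (u n) (ρ (n + 1)) (u (n + 1)) (φ (n + 1))) ∧
      (∀ n ≤ NT, ∀ i, 0 < ρ n i) ∧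
      (∀ n ≤ NT, EPB.lpNorm 1 (ρ n) = EPB.lpNorm 1 (ρ 0)) ∧
      (∃ (ξ : ℕ → EPB.Primal N) (τ : ℕ → ℝ),
        (∀ n < NT, ∀ i,
          (φ n i = φ (n + 1) i → ξ n i = φ n i) ∧
          (φ n i ≠ φ (n + 1) i →
            ξ n i ∈ Set.Ioo (min (φ n i) (φ (n + 1) i)) (max (φ n i) (φ (n + 1) i)))) ∧
        (∀ n < NT, τ (n + 1) =
          EPB.dissipation ε dt g (ρ n) (u n) (φ n) (ρ (n + 1)) (u (n + 1)) (φ (n + 1)) (ξ n)) ∧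
        (∀ n < NT, ∀ i,
          0 ≤ EPB.kinDissipation dt g (ρ n) (u n) (ρ (n + 1)) (u (n + 1)) i) ∧
        (∀ n < NT, 0 ≤ τ (n + 1)) ∧
        (∀ n ≤ NT,
          EPB.energy ε (ρ n) (u n) (φ n) + dt * ∑ k ∈ Finset.Icc 1 n, τ k =
            EPB.energy ε (ρ 0) (u 0) (φ 0))) ∧
      (∀ n ≤ NT, EPB.EllipticEstimates ε (ρ n) (φ n)) := by
  obtain ⟨K, hK⟩ := hg_lip
  have hNT' : (0 : ℝ) < NT := by exact_mod_cast hNT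
  have hdt0 : 0 < dt := by rw [hdt]; positivity
  have hg0 : 0 ≤ g 0 := (le_max_right _ _).trans (hg_lower 0)
  -- Positivity and the Poisson equation are the invariants needed to repeat a step.
  let S := {s : EPB.Primal N × EPB.Dual N × EPB.Primal N //
    (∀ i, 0 < s.1 i) ∧ EPB.Poisson ε s.1 s.2.2}
  have hstep : ∀ s : S, ∃ s' : S,
      EPB.Step ε dt g s.1.1 s.1.2.1 s'.1.1 s'.1.2.1 s'.1.2.2 := by
    rintro ⟨⟨ρ, u, φ⟩, hρ, hφ⟩
    obtain ⟨ρ', u', φ', hs, hpos⟩ := EPB.exists_step hdt0 hg_lower hK hg_diff u hρ hφ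
    exact ⟨⟨(ρ', u', φ'), hpos, hs.poisson⟩, hs⟩
  choose next hnext using hstep
  let s : ℕ → S := fun n => Nat.rec ⟨(ρ₀, u₀, φ₀), hρ₀, hφ₀⟩ (fun _ s => next s) n
  have hs : ∀ n, EPB.Step ε dt g (s n).1.1 (s n).1.2.1
      (s (n + 1)).1.1 (s (n + 1)).1.2.1 (s (n + 1)).1.2.2 := fun n => hnext (s n)
  choose ξ hξ using fun n i => EPB.exists_exp_neg_taylor ((s n).1.2.2 i) ((s (n + 1)).1.2.2 i)
  set D : ℕ → ℝ := fun n => EPB.dissipation ε dt g (s n).1.1 (s n).1.2.1 (s n).1.2.2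
    (s (n + 1)).1.1 (s (n + 1)).1.2.1 (s (n + 1)).1.2.2 (ξ n) with hD
  -- The dissipation is shifted by one index; the value of τ at 0 is irrelevant, since the sum
  -- starts at 1.
  refine ⟨fun n => (s n).1.1, fun n => (s n).1.2.1, fun n => (s n).1.2.2, ⟨rfl, rfl, rfl⟩,
    fun n _ => hs n, fun n _ => (s n).2.1, fun n _ => ?_, ⟨ξ, fun n => D (n - 1),
      fun n _ i => ⟨(hξ n i).1, (hξ n i).2.1⟩, fun n _ => rfl,
      fun n _ => EPB.kinDissipation_nonneg hdt0 g (fun i => ((s n).2.1 i).le) _ _ _,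
      fun n _ => EPB.dissipation_nonneg hdt0 ε hg0 (fun i => ((s n).2.1 i).le) _ _ _ _ _ _,
      fun n _ => ?_⟩, fun n _ => (s n).2.2.ellipticEstimates (s n).2.1⟩
  · induction n with
    | zero => rfl
    | succ n ih =>
      exact ((hs n).lpNorm_one_eq hdt0 (s n).2.1 (s (n + 1)).2.1).trans (ih (by omega))
  · induction n with
    | zero => simp
    | succ n ih =>
      rw [← ih (by omega), Finset.sum_Icc_succ_top (by omega), mul_add,
        ← (hs n).energy_add hdt0 (s n).2.2 fun i => (hξ n i).2.2]
      simp only [Nat.add_sub_cancel, hD]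
      ring
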